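/- Let $k\ge 1$, $T\ge 2$, and let $\mathcal K\subset\mathbb R^k$ (Euclidean norm) be closed and convex with $r\mathbb B^k\subseteq\mathcal K\subseteq R\,\mathbb B^k$, $0<r<R$. An oblivious adversary fixes * timestamps $0<l_1<\dots<l_T$ and $r_t>l_t$ ($t\in[T]$), all $2T$ of them distinct: prediction $x_t$ is requested at time $l_t$, and its feedback arrives at time $r_t$. Put $d_t=|\{s: l_t<l_s<r_t\}|$ (so that the feedback of round $t$ arrives in round $t+d_t$), $\sigma_t=|\{s: l_s<l_t<r_s\}|$, $d^\star_t=|\{s: l_t<r_s<r_t\}|$, $\sigma^\star_t=|\{s: l_s<r_t<r_s\}|$, $d_{\mathrm{tot}}=\sum_t d_t$, $\sigma_{\max}=\max_t\sigma_t$; * differentiable convex losses $f_t:\mathcal K\to\mathbb R$ with $\|\nabla f_t\|\le G$ and $|f_t|\le M$ on $\mathcal K$, each $\lambda$-strongly convex ($\lambda>0$): $f_t(y)\ge f_t(x)+\langle\nabla f_t(x),y-x\rangle+\frac\lambda2\|y-x\|^2$ for all $x,y\in\mathcal K$. Let $\nu=\frac{M}{Gr}$ and $\varphi(t)=r\min\{1,(\nu^2k^2\ln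 t/t)^{1/3}\}$. The algorithm $\mathcal W_{\mathrm{BCO}}(\mathcal B)$ maintains the current output $\bar z$ of a base algorithm $\mathcal B$. In round $t=1,\dots,T$ it draws $u_t$ uniformly from the unit sphere $\mathbb S^{k-1}$, independently of the past, and predicts $x_t=(1-\frac{\delta_t}{r})\bar z+\delta_tu_t$; then, for each $s$ with $s+d_s=t$, in increasing order of $r_s$, it receives $f_s(x_s)$, sends $(\frac k{\delta_s}f_s(x_s)u_s,\,d^\star_s,\,\sigma^\star_s)$ to $\mathcal B$, and replaces $\bar z$ by the new output of $\mathcal B$. Let $\mathcal B$ be P-FTRL: starting from any $z_1\in\mathcal K$, after the loss vectors $c_1,\dots,c_n$ it outputs $$z_{n+1}=\operatorname*{arg\,min}_{z\in\mathcal K}\ \sum_{m=1}^n\Big(\langle c_m,z\rangle+\tfrac{\alpha_m}{2}\|z_m-z\|^2\Big),\qquad \alpha_1=\tfrac1{\eta_1},\quad \alpha_m=\tfrac1{\eta_m}-\tfrac1{\eta_{m-1}}\ (m\ge2),$$ with $\eta_n=\frac1{n\lambda}$. Let the smoothing parameters be either fixed, $\delta_t=\varphi(T)$ for all $t$, or round-dependent,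 $\delta_t=\varphi(t)$ for $t\ge3$ with $\delta_1,\delta_2$ any values in $[\varphi(2),\varphi(3)]$. Then there is an absolute constant $C>0$, independent of all the above data, such that for $x^*\in\arg\min_{x\in\mathcal K}\sum_{t=1}^Tf_t(x)$ the regret $\sum_{t=1}^T(f_t(x_t)-f_t(x^*))$ is integrable and $$\mathbb E\Big[\sum_{t=1}^T\big(f_t(x_t)-f_t(x^*)\big)\Big]\le C\,\frac{G^2}{\lambda}\Big[\min\{\sigma_{\max}\ln T,\ \sqrt{d_{\mathrm{tot}}}\}+T^{2/3}(\ln T)^{1/3}(\nu k)^{2/3}\Big].$$ -/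

import Mathlib

open MeasureTheory ProbabilityTheory

noncomputable section

namespace DelayedBCO

/-- The ambient space `ℝ^k` with the Euclidean norm. -/
abbrev Vec (k : ℕ) := EuclideanSpace ℝ (Fin k)

/-- The unit sphere `𝕊^{k-1}` of `ℝ^k`. -/
abbrev UnitSphere (k : ℕ) := Metric.sphere (0 : Vec k) 1

/-- The uniform probability distribution on `𝕊^{k-1}`: normalized surface measure. -/
def unifSphere (k : ℕ) : Measure (UnitSphere k) :=
  ((volume : Measure (Vec k)).toSphere Set.univ)⁻¹ • (volume : Measure (Vec k)).toSphere

/-! ### Continuous time model for delays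

Rounds are indexed by `Fin T`; the index `t : Fin T` stands for round number `t + 1`. -/

/-- Latency intervals `(l t, r t)`: the prediction of round `t` is requested at time `l t` and its
feedback is revealed at time `r t`; all timestamps are distinct. -/
structure LatencyModel (T : ℕ) where
  l : Fin T → ℝ
  r : Fin T → ℝ
  l_pos : ∀ t, 0 < l t
  l_strictMono : StrictMono l
  l_lt_r : ∀ t, l t < r t
  r_injective : Function.Injective r
  l_ne_r : ∀ s t, l s ≠ r t

namespace LatencyModel

variable {T : ℕ} (τ : LatencyModel T)

/-- Delay `d_t`: number of predictions made during the `t`-th latency interval. -/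
def delay (t : Fin T) : ℕ :=
  (Finset.univ.filter fun s => τ.l t < τ.l s ∧ τ.l s < τ.r t).card

/-- Backlog `σ_t`: number of earlier predictions still awaiting feedback at time `l t`. -/
def backlog (t : Fin T) : ℕ :=
  (Finset.univ.filter fun s => τ.l s < τ.l t ∧ τ.l t < τ.r s).card

/-- Dual delay `d*_t`: number of observations made during the `t`-th latency interval. -/
def dualDelay (t : Fin T) : ℕ :=
  (Finset.univ.filter fun s => τ.l t < τ.r s ∧ τ.r s < τ.r t).card

/-- Dual backlog `σ*_t`: number of predictions still awaiting feedback at time `r t`. -/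
def dualBacklog (t : Fin T) : ℕ :=
  (Finset.univ.filter fun s => τ.l s < τ.r t ∧ τ.r t < τ.r s).card

/-- The total delay `d_tot`. -/
def totalDelay : ℕ := ∑ t, τ.delay t

/-- The maximal backlog `σ_max`. -/
def maxBacklog : ℕ := Finset.univ.sup τ.backlog

/-- The rounds listed in observation order, i.e. by increasing feedback time `r`. -/
def obsOrder : List (Fin T) :=
  (List.finRange T).mergeSort fun s t => decide (τ.r s ≤ τ.r t)

/-- The rounds `s` with `s + d_s = t`, whose feedback arrives at the end of round `t`, in
observation order. -/
def arrivals (t : Fin T) : List (Fin T) :=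
  τ.obsOrder.filter fun s => decide ((s : ℕ) + τ.delay s = (t : ℕ))

end LatencyModel

/-! ### Base algorithms and P-FTRL -/

/-- A message `(c, d*, σ*)` sent to a base algorithm: loss vector, lag, number of outstanding
lags. -/
abbrev Message (k : ℕ) := Vec k × ℕ × ℕ

/-- A (deterministic) base algorithm: the list of messages received so far, in chronological order,
is mapped to the current base prediction. -/
abbrev BaseAlgorithm (k : ℕ) := List (Message k) → Vec k

/-- A minimizer of `Φ` over `K`. -/
def argminOn {k : ℕ} (K : Set (Vec k)) (Φ : Vec k → ℝ) : Vec k :=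
  Classical.epsilon fun z => z ∈ K ∧ IsMinOn Φ K z

/-- `α_1 = 1/η_1` and `α_n = 1/η_n - 1/η_{n-1}` for `n ≥ 2`. -/
def proxWeight (η : ℕ → ℝ) (n : ℕ) : ℝ :=
  if n ≤ 1 then 1 / η n else 1 / η n - 1 / η (n - 1)

/-- State of P-FTRL after `n` updates: the number `n`, the current prediction `z_{n+1}` and the
accumulated objective `z ↦ ∑_{m ≤ n} (⟨c_m, z⟩ + α_m/2 ‖z_m - z‖²)`. -/
structure FTRLState (k : ℕ) where
  n : ℕ
  z : Vec k
  obj : Vec k → ℝ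

/-- The state before the first update, with prediction `z_1`. -/
def FTRLState.init {k : ℕ} (z₁ : Vec k) : FTRLState k := ⟨0, z₁, fun _ => 0⟩

/-- One P-FTRL update with the loss vector `c = c_{n+1}`. -/
def FTRLState.update {k : ℕ} (K : Set (Vec k)) (η : ℕ → ℝ) (S : FTRLState k) (c : Vec k) :
    FTRLState k :=
  let obj' : Vec k → ℝ := fun z =>
    S.obj z + (inner ℝ c z + proxWeight η (S.n + 1) / 2 * ‖S.z - z‖ ^ 2)
  ⟨S.n + 1, argminOn K obj', obj'⟩

/-- P-FTRL on `K` with learning rates `η` and initial point `z₁`: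
`z_{n+1} = argmin_{z ∈ K} ∑_{m ≤ n} (⟨c_m, z⟩ + α_m/2 ‖z_m - z‖²)`. -/
def pFTRL {k : ℕ} (K : Set (Vec k)) (η : ℕ → ℝ) (z₁ : Vec k) : BaseAlgorithm k := fun msgs =>
  (msgs.foldl (fun S m => S.update K η m.1) (FTRLState.init z₁)).z

/-! ### The bandit wrapper -/

/-- State of the wrapper: messages sent so far to the base algorithm, and predictions made so far
(entries of future rounds are `0` and not used). -/
structure WrapperState (k T : ℕ) where
  msgs : List (Message k)
  pred : Fin T → Vec k

section Wrapper

variable {k T : ℕ} (B : BaseAlgorithm k) (r : ℝ) (δ : ℕ → ℝ) (τ : LatencyModel T)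
  (f : Fin T → Vec k → ℝ) (u : Fin T → UnitSphere k)

/-- One round of the wrapper, with base algorithm `B`, smoothing parameters `δ` (indexed by the
round number `1, 2, …`), losses `f` and exploration directions `u`: predict
`x_t = (1 - δ_t/r) z̄ + δ_t u_t`, where `z̄` is the current output of `B`; then, for each `s` with
`s + d_s = t` in observation order, receive `f_s(x_s)` and send `((k/δ_s) f_s(x_s) u_s, d*_s, σ*_s)`
to `B`. -/
def wrapperRound (t : Fin T) (S : WrapperState k T) : WrapperState k T :=
  let x : Vec k := (1 - δ ((t : ℕ) + 1) / r) • B S.msgs + δ ((t : ℕ) + 1) • (u t : Vec k)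
  let pred' : Fin T → Vec k := Function.update S.pred t x
  { msgs := S.msgs ++ (τ.arrivals t).map fun s : Fin T =>
      (((k : ℝ) / δ ((s : ℕ) + 1) * f s (pred' s)) • (u s : Vec k), τ.dualDelay s, τ.dualBacklog s)
    pred := pred' }

/-- The state of the wrapper after the first `n` rounds. -/
def wrapperState : ℕ → WrapperState k T
  | 0 => ⟨[], fun _ => 0⟩
  | n + 1 => if h : n < T then wrapperRound B r δ τ f u ⟨n, h⟩ (wrapperState n) else wrapperState n

/-- The prediction `x_t` of the wrapper in round `t`. -/
def prediction (t : Fin T) : Vec k := (wrapperState B r δ τ f u T).pred t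

/-- The regret `R_T(v) = ∑_t (f_t(x_t) - f_t(v))` of the wrapper against the comparator `v`. -/
def regret (v : Vec k) : ℝ := ∑ t, (f t (prediction B r δ τ f u t) - f t v)

end Wrapper

/-! ### Losses and smoothing schedules -/

/-- `f` is `lam`-strongly convex on `K`, in first-order form. -/
def IsStronglyConvex {k : ℕ} (lam : ℝ) (K : Set (Vec k)) (f : Vec k → ℝ) : Prop :=
  ∀ x ∈ K, ∀ y ∈ K,
    f x + inner ℝ (gradientWithin f K x) (y - x) + lam / 2 * ‖y - x‖ ^ 2 ≤ f y

/-- `φ(t) = r min {1, (ν² k² ln t / t)^{1/3}}`. -/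
def smoothing (k : ℕ) (r ν : ℝ) (t : ℕ) : ℝ :=
  r * min 1 ((ν ^ 2 * (k : ℝ) ^ 2 * Real.log t / t) ^ (1 / 3 : ℝ))

/-- The round-dependent schedule `δ_t = φ(t)`. As `φ(1) = 0` is not an admissible smoothing
parameter and `φ` is only non-increasing from `t = 3` on (`φ(2) = φ(4) ≤ φ(3)`), the formula is
imposed for `t ≥ 3`, and `δ_1, δ_2` may be any values between `φ(2)` and `φ(3)`; this includes
`δ_2 = φ(2)` as well as the non-increasing choice `δ_1 = δ_2 = φ(3)`. -/
def IsRoundDependentSchedule (k : ℕ) (r ν : ℝ) (δ : ℕ → ℝ) : Prop :=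
  (∀ t, 3 ≤ t → δ t = smoothing k r ν t) ∧
    ∀ t, 1 ≤ t → t ≤ 2 → smoothing k r ν 2 ≤ δ t ∧ δ t ≤ smoothing k r ν 3

/-- The fixed schedule `δ_t = φ(T)` for all rounds `t`. -/
def IsFixedSchedule (k T : ℕ) (r ν : ℝ) (δ : ℕ → ℝ) : Prop :=
  ∀ t, 1 ≤ t → δ t = smoothing k r ν T

end DelayedBCO

end

/-!
For `u` uniform on the sphere, the mean of the one-point estimator `(k/δ) f(w + δu) u` has norm at
most `G` and acts as an approximate subgradient of `f` near `w`. This only needs convexity: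
reflecting `u` in the hyperplane orthogonal to a direction `y` pairs the points of the sphere along
lines parallel to `y`, and on such a line the difference quotient of `f` is controlled by
subgradients.

With `η_n = 1/(nλ)` every proximal weight of P-FTRL is `λ`, so its iterate after `m` updates is the
projection of the average of `z_j - c_j/λ` over those updates. Hence the regret in the quadratic
surrogate losses is logarithmic, and `m λ ‖z_m - z_n‖` is at most the norm of the sum of the loss
vectors received in between plus `λ ∑ ‖z_j - z_n‖` over `n ≤ j < m`; a discrete Gronwall argument
absorbs the second term at the price of replacing `m` by `n + 1`. In the sum of loss vectors the
conditional means contribute at most `G` each, whereas the noise terms are orthogonal in `L²` and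
add up like a square root.

The cost of the delay of round `s` is the drift between the iterate that chose the prediction and
the iterate that receives its feedback, which are `d*_s` updates apart. The delay therefore enters
through `∑ d*_s / (rank s + 1)`, where `rank s` is the position of round `s` in the order of
arrival. Since `∑ d*_s = d_tot` and `d*_s ≤ rank s`, this sum is `O(√d_tot)`; exchanging the order
of summation and using `σ*_s ≤ σ_max`, it is also `O(σ_max log T)`. The remaining terms
`(kM/δ)² log T / λ` and `(G²/λ) ∑ δ_t / r` are balanced by the choice of `δ`.
-/

namespace DelayedBCO

/-! ### Integration over the sphere -/

lemma integrable_of_continuous_of_compactSpace {X E : Type*} [TopologicalSpace X] [CompactSpace X]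
    [MeasurableSpace X] [OpensMeasurableSpace X] [NormedAddCommGroup E]
    [SecondCountableTopologyEither X E] {μ : Measure X} [IsFiniteMeasure μ] {F : X → E}
    (hF : Continuous F) : Integrable F μ :=
  hF.integrable_of_hasCompactSupport (.of_compactSpace F)

section Sphere

open scoped Pointwise

/-- The homeomorphism of the unit sphere induced by a linear isometry of the ambient space. -/
def sphereHomeomorph {E : Type*} [NormedAddCommGroup E] [NormedSpace ℝ E] (φ : E ≃ₗᵢ[ℝ] E) :
    Metric.sphere (0 : E) 1 ≃ₜ Metric.sphere (0 : E) 1 :=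
  φ.toHomeomorph.subtype fun x => by simp

@[simp]
lemma coe_sphereHomeomorph {E : Type*} [NormedAddCommGroup E] [NormedSpace ℝ E] (φ : E ≃ₗᵢ[ℝ] E)
    (u : Metric.sphere (0 : E) 1) : (sphereHomeomorph φ u : E) = φ u :=
  rfl

lemma map_sphereHomeomorph_toSphere {E : Type*} [NormedAddCommGroup E] [InnerProductSpace ℝ E]
    [FiniteDimensional ℝ E] [MeasurableSpace E] [BorelSpace E] (φ : E ≃ₗᵢ[ℝ] E) :
    (volume : Measure E).toSphere.map (sphereHomeomorph φ) = (volume : Measure E).toSphere := by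
  ext s hs
  have hcone : Set.Ioo (0 : ℝ) 1 • (Subtype.val '' (sphereHomeomorph φ ⁻¹' s)) =
      φ ⁻¹' (Set.Ioo (0 : ℝ) 1 • (Subtype.val '' s)) := by
    ext x
    simp only [Set.mem_smul, Set.mem_image, Set.mem_preimage]
    constructor
    · rintro ⟨a, ha, _, ⟨u, hu, rfl⟩, rfl⟩
      exact ⟨a, ha, _, ⟨sphereHomeomorph φ u, hu, rfl⟩, (map_smul φ a (u : E)).symm⟩
    · rintro ⟨a, ha, _, ⟨u, hu, rfl⟩, hux⟩
      refine ⟨a, ha, _, ⟨(sphereHomeomorph φ).symm u, by simpa using hu, rfl⟩, φ.injective ?_⟩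
      rw [map_smul, ← coe_sphereHomeomorph, Homeomorph.apply_symm_apply, hux]
  have hmeas : Measurable (sphereHomeomorph φ) := (sphereHomeomorph φ).measurable
  rw [Measure.map_apply hmeas hs, Measure.toSphere_apply' _ (hmeas hs),
    Measure.toSphere_apply' _ hs, hcone]
  congr 1
  exact φ.measurePreserving.measure_preimage_equiv (f := φ.toMeasurableEquiv) _

variable {k : ℕ}

instance isProbabilityMeasure_unifSphere [NeZero k] : IsProbabilityMeasure (unifSphere k) where
  measure_univ :=
    ENNReal.inv_mul_cancel (Measure.measure_univ_ne_zero.2 (Measure.toSphere_ne_zero _))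
      (measure_ne_top _ _)

lemma measurePreserving_sphereHomeomorph (φ : Vec k ≃ₗᵢ[ℝ] Vec k) :
    MeasurePreserving (sphereHomeomorph φ) (unifSphere k) (unifSphere k) where
  measurable := (sphereHomeomorph φ).measurable
  map_eq := by rw [unifSphere, Measure.map_smul, map_sphereHomeomorph_toSphere]

lemma integral_comp_sphereHomeomorph (φ : Vec k ≃ₗᵢ[ℝ] Vec k) {E : Type*} [NormedAddCommGroup E]
    [NormedSpace ℝ E] (F : UnitSphere k → E) :
    ∫ u, F (sphereHomeomorph φ u) ∂unifSphere k = ∫ u, F u ∂unifSphere k :=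
  (measurePreserving_sphereHomeomorph φ).integral_comp
    (sphereHomeomorph φ).measurableEmbedding F

lemma integral_inner_sq_eq_of_norm_eq {y y' : Vec k} (h : ‖y‖ = ‖y'‖) :
    ∫ u : UnitSphere k, (inner ℝ (u : Vec k) y) ^ 2 ∂unifSphere k =
      ∫ u : UnitSphere k, (inner ℝ (u : Vec k) y') ^ 2 ∂unifSphere k := by
  let φ := (Submodule.span ℝ {y - y'})ᗮ.reflection
  have hφ : φ y = y' := Submodule.reflection_sub h
  rw [← integral_comp_sphereHomeomorph φ fun u => (inner ℝ (u : Vec k) y') ^ 2]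
  simp only [← hφ, coe_sphereHomeomorph, LinearIsometryEquiv.inner_map_map]

lemma integral_inner_sq [NeZero k] (y : Vec k) :
    ∫ u : UnitSphere k, (inner ℝ (u : Vec k) y) ^ 2 ∂unifSphere k = ‖y‖ ^ 2 / k := by
  let b := EuclideanSpace.basisFun (Fin k) ℝ
  have hpythagoras (u : UnitSphere k) : ∑ i, (inner ℝ (u : Vec k) (‖y‖ • b i)) ^ 2 = ‖y‖ ^ 2 := by
    have := b.sum_sq_norm_inner_left (u : Vec k)
    simp only [Real.norm_eq_abs, sq_abs, norm_eq_of_mem_sphere, one_pow] at this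
    simp only [inner_smul_right, mul_pow, ← Finset.mul_sum, this, mul_one]
  rw [eq_div_iff (NeZero.ne _), mul_comm]
  calc (k : ℝ) * ∫ u : UnitSphere k, (inner ℝ (u : Vec k) y) ^ 2 ∂unifSphere k
      = ∑ i : Fin k, ∫ u : UnitSphere k, (inner ℝ (u : Vec k) (‖y‖ • b i)) ^ 2 ∂unifSphere k := by
        rw [← Finset.sum_congr rfl fun i _ =>
          integral_inner_sq_eq_of_norm_eq (y := y) (by simp [norm_smul, b])]
        simp
    _ = ∫ u : UnitSphere k, ∑ i, (inner ℝ (u : Vec k) (‖y‖ • b i)) ^ 2 ∂unifSphere k := by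
        rw [integral_finsetSum _ fun _ _ =>
          integrable_of_continuous_of_compactSpace (by fun_prop)]
    _ = ‖y‖ ^ 2 := by simp [hpythagoras]

end Sphere

/-! ### Strong subgradients and the one-point gradient -/

/-- `g` selects at each point of `K` a subgradient of `f` of norm at most `G`, and these
subgradients witness the `lam`-strong convexity of `f` on `K`. Differentiability of `f` is not
assumed; the gradient of a differentiable strongly convex function is an example. -/
structure IsStrongSubgradient {E : Type*} [NormedAddCommGroup E] [InnerProductSpace ℝ E]
    (K : Set E) (G lam : ℝ) (f : E → ℝ) (g : E → E) : Prop where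
  norm_le : ∀ x ∈ K, ‖g x‖ ≤ G
  le : ∀ x ∈ K, ∀ y ∈ K, f x + inner ℝ (g x) (y - x) + lam / 2 * ‖y - x‖ ^ 2 ≤ f y

namespace IsStrongSubgradient

section InnerProductSpace

variable {E : Type*} [NormedAddCommGroup E] [InnerProductSpace ℝ E] {K : Set E} {G lam : ℝ}
  {f : E → ℝ} {g : E → E} {x y z : E}

lemma nonneg (h : IsStrongSubgradient K G lam f g) (hx : x ∈ K) : 0 ≤ G :=
  (norm_nonneg _).trans (h.norm_le x hx)

lemma inner_le (h : IsStrongSubgradient K G lam f g) (hx : x ∈ K) (y : E) :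
    inner ℝ (g x) y ≤ G * ‖y‖ :=
  (real_inner_le_norm _ _).trans (mul_le_mul_of_nonneg_right (h.norm_le x hx) (norm_nonneg _))

lemma sub_le_inner_sub (h : IsStrongSubgradient K G lam f g) (hx : x ∈ K) (hy : y ∈ K) :
    f x - f y ≤ inner ℝ (g x) (x - y) - lam / 2 * ‖x - y‖ ^ 2 := by
  have := h.le x hx y hy
  rw [← neg_sub x y, inner_neg_right, norm_neg] at this
  linarith

lemma sub_le_inner (h : IsStrongSubgradient K G lam f g) (hlam : 0 ≤ lam) (hx : x ∈ K)
    (hy : y ∈ K) : f x - f y ≤ inner ℝ (g x) (x - y) :=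
  (h.sub_le_inner_sub hx hy).trans (sub_le_self _ (by positivity))

lemma sub_le (h : IsStrongSubgradient K G lam f g) (hlam : 0 ≤ lam) (hx : x ∈ K) (hy : y ∈ K) :
    f x - f y ≤ G * ‖x - y‖ :=
  (h.sub_le_inner hlam hx hy).trans (h.inner_le hx _)

lemma continuousOn (h : IsStrongSubgradient K G lam f g) (hlam : 0 ≤ lam) : ContinuousOn f K :=
  (LipschitzOnWith.of_le_add_mul' G fun x hx y hy => by
    have := h.sub_le hlam hx hy
    rw [dist_eq_norm]
    linarith).continuousOn

lemma norm_sub_le (h : IsStrongSubgradient K G lam f g) (hlam : 0 < lam) (hx : x ∈ K)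
    (hy : y ∈ K) : ‖x - y‖ ≤ 2 * G / lam := by
  have hxy := (h.sub_le_inner_sub hx hy).trans (sub_le_sub_right (h.inner_le hx _) _)
  have hyx := (h.sub_le_inner_sub hy hx).trans (sub_le_sub_right (h.inner_le hy _) _)
  rw [norm_sub_rev] at hyx
  have hG := h.nonneg hx
  rw [le_div_iff₀ hlam]
  rcases (norm_nonneg (x - y)).eq_or_lt with h0 | h0
  · rw [← h0, zero_mul]
    positivity
  · nlinarith

lemma isBounded (h : IsStrongSubgradient K G lam f g) (hlam : 0 < lam) : Bornology.IsBounded K :=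
  Metric.isBounded_iff.2 ⟨2 * G / lam, fun _ hx _ hy =>
    (dist_eq_norm _ _).trans_le (h.norm_sub_le hlam hx hy)⟩

lemma radius_le [Nontrivial E] (h : IsStrongSubgradient K G lam f g) (hlam : 0 < lam) {r : ℝ}
    (hr : 0 ≤ r) (hrK : Metric.closedBall 0 r ⊆ K) : r ≤ 2 * G / lam := by
  obtain ⟨v, hv⟩ := exists_norm_eq E hr
  simpa [hv] using h.norm_sub_le hlam (x := v) (y := 0) (hrK (by simp [hv])) (hrK (by simp [hr]))

lemma mul_sq_radius_le [Nontrivial E] (h : IsStrongSubgradient K G lam f g) {r M : ℝ} (hr : 0 ≤ r)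
    (hrK : Metric.closedBall 0 r ⊆ K) (hM : ∀ x ∈ K, |f x| ≤ M) : lam * r ^ 2 ≤ 4 * M := by
  obtain ⟨v, hv⟩ := exists_norm_eq E hr
  have h0 : (0 : E) ∈ K := hrK (by simp [hr])
  have hvK : v ∈ K := hrK (by simp [hv])
  have hnvK : -v ∈ K := hrK (by simp [hv])
  have hpos := h.le 0 h0 v hvK
  have hneg := h.le 0 h0 (-v) hnvK
  simp only [sub_zero, inner_neg_right, norm_neg, hv] at hpos hneg
  linarith [(abs_le.1 (hM 0 h0)).1, (abs_le.1 (hM v hvK)).2, (abs_le.1 (hM (-v) hnvK)).2]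

lemma pos [Nontrivial E] (h : IsStrongSubgradient K G lam f g) (hlam : 0 < lam) {r : ℝ}
    (hr : 0 < r) (hrK : Metric.closedBall 0 r ⊆ K) : 0 < G := by
  linarith [(div_pos_iff_of_pos_right hlam).1 (hr.trans_le (h.radius_le hlam hr.le hrK))]

lemma bound_pos [Nontrivial E] (h : IsStrongSubgradient K G lam f g) (hlam : 0 < lam) {r M : ℝ}
    (hr : 0 < r) (hrK : Metric.closedBall 0 r ⊆ K) (hM : ∀ x ∈ K, |f x| ≤ M) : 0 < M := by
  have : 0 < lam * r ^ 2 := by positivity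
  linarith [h.mul_sq_radius_le hr.le hrK hM]

lemma sub_mul_le_of_sub_eq_smul (h : IsStrongSubgradient K G lam f g) (hlam : 0 ≤ lam)
    {p q : E} {t Q : ℝ} (hp : p ∈ K) (hq : q ∈ K) (hpq : p - q = t • y)
    (hgp : inner ℝ (g p) y ≤ Q) (hgq : inner ℝ (g q) y ≤ Q) : (f p - f q) * t ≤ Q * t ^ 2 := by
  have hfp := h.sub_le_inner hlam hp hq
  have hfq := h.sub_le_inner hlam hq hp
  rw [hpq, inner_smul_right] at hfp
  rw [← neg_sub p q, hpq, inner_neg_right, inner_smul_right] at hfq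
  rcases le_total 0 t with ht | ht
  · nlinarith [mul_le_mul_of_nonneg_left hgp ht]
  · nlinarith [mul_le_mul_of_nonpos_left hgq ht]

lemma half_mul_norm_sub_sq_sub_le (h : IsStrongSubgradient K G lam f g) (hlam : 0 < lam)
    (hx : x ∈ K) (hy : y ∈ K) (hz : z ∈ K) :
    lam / 2 * (‖x - z‖ ^ 2 - ‖y - z‖ ^ 2) ≤ 2 * (G * ‖x - y‖) := by
  have hxz := h.norm_sub_le hlam hx hz
  have hyz := h.norm_sub_le hlam hy hz
  have hdiff : ‖x - z‖ - ‖y - z‖ ≤ ‖x - y‖ := by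
    simpa only [sub_sub_sub_cancel_right] using norm_sub_norm_le (x - z) (y - z)
  calc lam / 2 * (‖x - z‖ ^ 2 - ‖y - z‖ ^ 2)
      = lam / 2 * ((‖x - z‖ - ‖y - z‖) * (‖x - z‖ + ‖y - z‖)) := by ring
    _ ≤ lam / 2 * (‖x - y‖ * (2 * G / lam + 2 * G / lam)) := by gcongr
    _ = 2 * (G * ‖x - y‖) := by field_simp; ring

lemma sub_le_inner_of_norm_sub_le (h : IsStrongSubgradient K G lam f g) (hlam : 0 < lam)
    {p v : E} {ρ : ℝ} (hx : x ∈ K) (hp : p ∈ K) (hz : z ∈ K) (hv : v ∈ K) (hxp : ‖x - p‖ ≤ ρ)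
    (hzp : ‖z - p‖ ≤ ρ) :
    f x - f v ≤ inner ℝ (g p) (z - v) - lam / 2 * ‖z - v‖ ^ 2 + 4 * (G * ρ) := by
  have hG := h.nonneg hx
  have hfx := (h.sub_le hlam.le hx hp).trans (mul_le_mul_of_nonneg_left hxp hG)
  have hfp := h.sub_le_inner_sub hp hv
  have hinner : inner ℝ (g p) (p - v) ≤ inner ℝ (g p) (z - v) + G * ρ := by
    rw [← sub_add_sub_cancel p z v, inner_add_right, add_comm]
    rw [norm_sub_rev] at hzp
    gcongr
    exact (h.inner_le hp _).trans (mul_le_mul_of_nonneg_left hzp hG)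
  have hsq := (h.half_mul_norm_sub_sq_sub_le hlam hz hp hv).trans
    (mul_le_mul_of_nonneg_left (mul_le_mul_of_nonneg_left hzp hG) zero_le_two)
  linarith

end InnerProductSpace

end IsStrongSubgradient

section OnePoint

variable {k : ℕ} {f : Vec k → ℝ} {w y : Vec k} {δ : ℝ}

/-- The mean of the one-point estimator `(k/δ) f(w + δu) u` for a uniformly distributed direction
`u`. If `f` is smooth, this is the gradient at `w` of the average of `f` over balls of radius
`δ`. -/
noncomputable def onePointGradient (f : Vec k → ℝ) (w : Vec k) (δ : ℝ) : Vec k :=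
  ∫ u : UnitSphere k, ((k : ℝ) / δ * f (w + δ • (u : Vec k))) • (u : Vec k) ∂unifSphere k

lemma add_smul_mem_closedBall (w : Vec k) (hδ : 0 ≤ δ) (u : UnitSphere k) :
    w + δ • (u : Vec k) ∈ Metric.closedBall w δ := by
  simp [norm_smul, abs_of_nonneg hδ]

lemma continuous_comp_add_smul (hf : ContinuousOn f (Metric.closedBall w δ)) (hδ : 0 ≤ δ) :
    Continuous fun u : UnitSphere k => f (w + δ • (u : Vec k)) :=
  hf.comp_continuous (by fun_prop) (add_smul_mem_closedBall w hδ)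

lemma inner_onePointGradient [NeZero k] (hf : ContinuousOn f (Metric.closedBall w δ)) (hδ : 0 ≤ δ)
    (y : Vec k) :
    inner ℝ (onePointGradient f w δ) y =
      k / δ * ∫ u : UnitSphere k, f (w + δ • (u : Vec k)) * inner ℝ (u : Vec k) y
        ∂unifSphere k := by
  have hcont : Continuous fun u : UnitSphere k =>
      ((k : ℝ) / δ * f (w + δ • (u : Vec k))) • (u : Vec k) :=
    (continuous_const.mul (continuous_comp_add_smul hf hδ)).smul continuous_subtype_val
  rw [onePointGradient, real_inner_comm,
    ← integral_inner (integrable_of_continuous_of_compactSpace hcont), ← integral_const_mul]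
  congr 1 with u
  rw [inner_smul_right, real_inner_comm]
  ring

lemma inner_reflection_orthogonal_singleton (u y : Vec k) :
    inner ℝ ((Submodule.span ℝ {y})ᗮ.reflection u) y = -inner ℝ u y := by
  let φ := (Submodule.span ℝ {y})ᗮ.reflection
  have hφy : φ (-y) = y := by
    rw [map_neg, Submodule.reflection_orthogonalComplement_singleton_eq_neg, neg_neg]
  calc inner ℝ (φ u) y = inner ℝ (φ u) (φ (-y)) := by rw [hφy]
    _ = -inner ℝ u y := by rw [LinearIsometryEquiv.inner_map_map, inner_neg_right]

lemma sub_reflection_orthogonal_singleton (u y : Vec k) :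
    u - (Submodule.span ℝ {y})ᗮ.reflection u = (2 * inner ℝ u y / ‖y‖ ^ 2) • y := by
  rw [Submodule.reflection_orthogonal_apply, Submodule.reflection_singleton_apply,
    sub_neg_eq_add, add_sub_cancel, ← Nat.cast_smul_eq_nsmul ℝ, smul_smul, real_inner_comm]
  simp [mul_div_assoc]

lemma integral_mul_inner_eq_sub_reflection [NeZero k]
    (hf : ContinuousOn f (Metric.closedBall w δ)) (hδ : 0 ≤ δ) (y : Vec k) :
    ∫ u : UnitSphere k, f (w + δ • (u : Vec k)) * inner ℝ (u : Vec k) y ∂unifSphere k =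
      (∫ u : UnitSphere k, (f (w + δ • (u : Vec k)) -
        f (w + δ • (Submodule.span ℝ {y})ᗮ.reflection (u : Vec k))) * inner ℝ (u : Vec k) y
          ∂unifSphere k) / 2 := by
  let φ := (Submodule.span ℝ {y})ᗮ.reflection
  have hcont := continuous_comp_add_smul hf hδ
  have hcont_mul : Continuous fun u : UnitSphere k =>
      f (w + δ • (u : Vec k)) * inner ℝ (u : Vec k) y := hcont.mul (by fun_prop)
  have hcont_reflect : Continuous fun u : UnitSphere k =>
      f (w + δ • φ u) * inner ℝ (u : Vec k) y :=
    (hcont.comp (sphereHomeomorph φ).continuous).mul (by fun_prop)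
  have hreflect : ∫ u : UnitSphere k, f (w + δ • φ u) * inner ℝ (u : Vec k) y ∂unifSphere k =
      -∫ u : UnitSphere k, f (w + δ • (u : Vec k)) * inner ℝ (u : Vec k) y ∂unifSphere k := by
    rw [← integral_comp_sphereHomeomorph φ, ← integral_neg]
    congr 1 with u
    rw [coe_sphereHomeomorph, Submodule.reflection_reflection,
      inner_reflection_orthogonal_singleton, mul_neg]
  simp only [sub_mul]
  rw [integral_sub (integrable_of_continuous_of_compactSpace hcont_mul)
    (integrable_of_continuous_of_compactSpace hcont_reflect), hreflect]
  ring

end OnePoint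

namespace IsStrongSubgradient

variable {k : ℕ} [NeZero k] {K : Set (Vec k)} {G lam : ℝ} {f : Vec k → ℝ} {g : Vec k → Vec k}
  {w y : Vec k} {δ : ℝ}

-- Reflecting `u` in `y`ᗮ pairs the points of the sphere along lines parallel to `y`; on each line
-- the difference quotient of `f` is bounded by `⟪g p, y⟫`, so no divergence theorem is needed.
lemma inner_onePointGradient_le (h : IsStrongSubgradient K G lam f g) (hlam : 0 ≤ lam)
    (hδ : 0 < δ) (hw : Metric.closedBall w δ ⊆ K) {Q : ℝ}
    (hQ : ∀ p ∈ Metric.closedBall w δ, inner ℝ (g p) y ≤ Q) :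
    inner ℝ (onePointGradient f w δ) y ≤ Q := by
  rcases eq_or_ne y 0 with rfl | hy
  · simpa using hQ w (Metric.mem_closedBall_self hδ.le)
  have : 0 < ‖y‖ := norm_pos_iff.2 hy
  have hf := (h.continuousOn hlam).mono hw
  have hcont := continuous_comp_add_smul hf hδ.le
  let φ := (Submodule.span ℝ {y})ᗮ.reflection
  have hcont_diff : Continuous fun u : UnitSphere k =>
      (f (w + δ • (u : Vec k)) - f (w + δ • φ u)) * inner ℝ (u : Vec k) y :=
    (hcont.sub (hcont.comp (sphereHomeomorph φ).continuous)).mul (by fun_prop)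
  have hpair (u : UnitSphere k) : (f (w + δ • (u : Vec k)) - f (w + δ • φ u)) *
      inner ℝ (u : Vec k) y ≤ 2 * δ * Q / ‖y‖ ^ 2 * inner ℝ (u : Vec k) y ^ 2 := by
    have hp := add_smul_mem_closedBall w hδ.le u
    have hq := add_smul_mem_closedBall w hδ.le (sphereHomeomorph φ u)
    have hline := h.sub_mul_le_of_sub_eq_smul hlam (hw hp) (hw hq)
      (t := δ * (2 * inner ℝ (u : Vec k) y / ‖y‖ ^ 2)) (by
        rw [coe_sphereHomeomorph, add_sub_add_left_eq_sub, ← smul_sub,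
          sub_reflection_orthogonal_singleton, smul_smul]) (hQ _ hp) (hQ _ hq)
    rw [coe_sphereHomeomorph] at hline
    refine le_of_mul_le_mul_left ?_ (show 0 < δ * 2 / ‖y‖ ^ 2 by positivity)
    calc _ = (f (w + δ • (u : Vec k)) - f (w + δ • φ u)) *
          (δ * (2 * inner ℝ (u : Vec k) y / ‖y‖ ^ 2)) := by ring
      _ ≤ _ := hline
      _ = _ := by ring
  have hintegral := integral_mono (μ := unifSphere k)
    (integrable_of_continuous_of_compactSpace hcont_diff)
    (integrable_of_continuous_of_compactSpace (by fun_prop)) hpair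
  rw [integral_const_mul, integral_inner_sq] at hintegral
  calc inner ℝ (onePointGradient f w δ) y
      = k / δ * ((∫ u : UnitSphere k, (f (w + δ • (u : Vec k)) - f (w + δ • φ u)) *
          inner ℝ (u : Vec k) y ∂unifSphere k) / 2) := by
        rw [inner_onePointGradient hf hδ.le, integral_mul_inner_eq_sub_reflection hf hδ.le]
    _ ≤ k / δ * (2 * δ * Q / ‖y‖ ^ 2 * (‖y‖ ^ 2 / k) / 2) := by gcongr
    _ = Q := by have := NeZero.ne (k : ℝ); field_simp

lemma le_inner_onePointGradient (h : IsStrongSubgradient K G lam f g) (hlam : 0 ≤ lam)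
    (hδ : 0 < δ) (hw : Metric.closedBall w δ ⊆ K) {Q : ℝ}
    (hQ : ∀ p ∈ Metric.closedBall w δ, Q ≤ inner ℝ (g p) y) :
    Q ≤ inner ℝ (onePointGradient f w δ) y := by
  have := h.inner_onePointGradient_le hlam hδ hw (y := -y) (Q := -Q) fun p hp => by
    rw [inner_neg_right]
    exact neg_le_neg (hQ p hp)
  rwa [inner_neg_right, neg_le_neg_iff] at this

lemma norm_onePointGradient_le (h : IsStrongSubgradient K G lam f g) (hlam : 0 ≤ lam)
    (hδ : 0 < δ) (hw : Metric.closedBall w δ ⊆ K) : ‖onePointGradient f w δ‖ ≤ G := by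
  set c := onePointGradient f w δ
  have hc : ‖c‖ * ‖c‖ ≤ G * ‖c‖ := by
    rw [← real_inner_self_eq_norm_mul_norm]
    exact h.inner_onePointGradient_le hlam hδ hw fun p hp => h.inner_le (hw hp) _
  rcases (norm_nonneg c).eq_or_lt with h0 | h0
  · rw [← h0]
    exact h.nonneg (hw (Metric.mem_closedBall_self hδ.le))
  · exact le_of_mul_le_mul_right hc h0

lemma sub_le_inner_onePointGradient (h : IsStrongSubgradient K G lam f g) (hlam : 0 < lam)
    (hδ : 0 < δ) {r : ℝ} (hr : 0 < r) (hrK : Metric.closedBall 0 r ⊆ K) {z v x : Vec k}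
    (hz : z ∈ K) (hv : v ∈ K) (hw : Metric.closedBall ((1 - δ / r) • z) δ ⊆ K)
    (hx : x ∈ Metric.closedBall ((1 - δ / r) • z) δ) :
    f x - f v ≤ inner ℝ (onePointGradient f ((1 - δ / r) • z) δ) (z - v)
      - lam / 2 * ‖z - v‖ ^ 2 + 16 * (δ / r) * (G ^ 2 / lam) := by
  set D := 2 * G / lam
  set ρ := 2 * (δ / r * D)
  have hrD : r ≤ D := h.radius_le hlam hr.le hrK
  have hzD : ‖z‖ ≤ D := by
    simpa using h.norm_sub_le hlam hz (hrK (Metric.mem_closedBall_self hr.le))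
  have hδD : δ ≤ δ / r * D := by
    calc δ = δ / r * r := by field_simp
      _ ≤ δ / r * D := by gcongr
  have hxp (p) (hp : p ∈ Metric.closedBall ((1 - δ / r) • z) δ) : ‖x - p‖ ≤ ρ := by
    rw [← dist_eq_norm]
    linarith [dist_triangle_right x p ((1 - δ / r) • z), Metric.mem_closedBall.1 hx,
      Metric.mem_closedBall.1 hp]
  have hzp (p) (hp : p ∈ Metric.closedBall ((1 - δ / r) • z) δ) : ‖z - p‖ ≤ ρ := by
    have hcenter : dist z ((1 - δ / r) • z) ≤ δ / r * D := by
      rw [dist_eq_norm, sub_smul, one_smul, sub_sub_cancel, norm_smul,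
        Real.norm_of_nonneg (by positivity)]
      gcongr
    rw [← dist_eq_norm]
    linarith [dist_triangle_right z p ((1 - δ / r) • z), Metric.mem_closedBall.1 hp]
  have hmean := h.le_inner_onePointGradient hlam.le hδ hw (y := z - v)
    (Q := f x - f v + lam / 2 * ‖z - v‖ ^ 2 - 4 * (G * ρ)) fun p hp => by
      linarith [h.sub_le_inner_of_norm_sub_le hlam (hw hx) (hw hp) hz hv (hxp p hp) (hzp p hp)]
  have hρ : 4 * (G * ρ) = 16 * (δ / r) * (G ^ 2 / lam) := by simp only [ρ, D]; ring
  linarith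

end IsStrongSubgradient

/-! ### P-FTRL with strongly convex regularization -/

section Quadratic

variable {E : Type*} [NormedAddCommGroup E] [InnerProductSpace ℝ E] {K : Set E} {x y p q : E}
  {μ : ℝ}

lemma inner_nonneg_of_forall_le_add_sq (hK : Convex ℝ K) (hx : x ∈ K)
    (h : ∀ z ∈ K, 0 ≤ inner ℝ p (z - x) + μ * ‖z - x‖ ^ 2) (hy : y ∈ K) :
    0 ≤ inner ℝ p (y - x) := by
  have hlim : Filter.Tendsto (fun t : ℝ => inner ℝ p (y - x) + t * (μ * ‖y - x‖ ^ 2))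
      (nhdsWithin 0 (Set.Ioi 0)) (nhds (inner ℝ p (y - x))) :=
    (Continuous.tendsto' (by fun_prop) _ _ (by simp)).mono_left nhdsWithin_le_nhds
  refine ge_of_tendsto hlim ?_
  filter_upwards [Ioc_mem_nhdsGT one_pos] with t ht
  have hle := h _ (hK.add_smul_sub_mem hx hy ⟨ht.1.le, ht.2⟩)
  rw [add_sub_cancel_left, inner_smul_right, norm_smul, mul_pow, Real.norm_eq_abs, sq_abs] at hle
  exact nonneg_of_mul_nonneg_right (by linarith) ht.1

lemma mul_norm_sub_le_of_inner_nonneg (hx : 0 ≤ inner ℝ (μ • x - p) (y - x))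
    (hy : 0 ≤ inner ℝ (μ • y - q) (x - y)) : μ * ‖x - y‖ ≤ ‖p - q‖ := by
  have hsq : μ * ‖x - y‖ ^ 2 ≤ ‖p - q‖ * ‖x - y‖ := by
    refine le_trans ?_ (real_inner_le_norm (p - q) (x - y))
    rw [← neg_sub x y, inner_neg_right] at hx
    rw [← real_inner_self_eq_norm_sq]
    simp only [inner_sub_left, inner_smul_left, RCLike.conj_to_real] at hx hy ⊢
    linarith
  rcases (norm_nonneg (x - y)).eq_or_lt with h0 | h0
  · rw [← h0, mul_zero]
    exact norm_nonneg _
  · exact le_of_mul_le_mul_right (by linarith) h0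

end Quadratic

section FTRL

variable {k : ℕ}

/-- The learning rates `η_n = 1 / (n λ)`, for which all proximal weights of P-FTRL equal `λ`. -/
noncomputable abbrev strongRate (lam : ℝ) : ℕ → ℝ := fun n => 1 / (n * lam)

lemma proxWeight_strongRate {lam : ℝ} (n : ℕ) :
    proxWeight (strongRate lam) (n + 1) = lam := by
  unfold proxWeight strongRate
  split_ifs with h
  · obtain rfl : n = 0 := by omega
    simp
  · simp only [one_div, inv_inv, Nat.add_sub_cancel]
    push_cast
    ring

/-- The states of P-FTRL along the sequence of loss vectors `c`, indexed from `0`. -/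
noncomputable def ftrlState (K : Set (Vec k)) (lam : ℝ) (z₁ : Vec k) (c : ℕ → Vec k) :
    ℕ → FTRLState k
  | 0 => FTRLState.init z₁
  | m + 1 => (ftrlState K lam z₁ c m).update K (strongRate lam) (c m)

/-- The prediction of P-FTRL after `m` updates; in the paper's indexing this is `z_{m+1}`. -/
noncomputable def ftrlIter (K : Set (Vec k)) (lam : ℝ) (z₁ : Vec k) (c : ℕ → Vec k) (m : ℕ) :
    Vec k :=
  (ftrlState K lam z₁ c m).z

/-- The P-FTRL objective after `m` updates. -/
noncomputable def ftrlObj (K : Set (Vec k)) (lam : ℝ) (z₁ : Vec k) (c : ℕ → Vec k) (m : ℕ)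
    (z : Vec k) : ℝ :=
  ∑ j ∈ Finset.range m, (inner ℝ (c j) z + lam / 2 * ‖ftrlIter K lam z₁ c j - z‖ ^ 2)

/-- The linear part of the P-FTRL objective: up to a constant, the objective after `m` updates is
`m λ / 2 ‖z‖² - ⟪ftrlDual m, z⟫`, so that the prediction is the projection of
`ftrlDual m / (m λ)` onto `K`. -/
noncomputable def ftrlDual (K : Set (Vec k)) (lam : ℝ) (z₁ : Vec k) (c : ℕ → Vec k) (m : ℕ) :
    Vec k :=
  ∑ j ∈ Finset.range m, (lam • ftrlIter K lam z₁ c j - c j)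

variable {K : Set (Vec k)} {lam : ℝ} {z₁ : Vec k} {c : ℕ → Vec k}

lemma ftrlState_n (m : ℕ) : (ftrlState K lam z₁ c m).n = m := by
  induction m with
  | zero => rfl
  | succ m ih => simp [ftrlState, FTRLState.update, ih]

lemma ftrlObj_succ (m : ℕ) (z : Vec k) :
    ftrlObj K lam z₁ c (m + 1) z = ftrlObj K lam z₁ c m z +
      (inner ℝ (c m) z + lam / 2 * ‖ftrlIter K lam z₁ c m - z‖ ^ 2) :=
  Finset.sum_range_succ _ _

lemma ftrlDual_succ (m : ℕ) :
    ftrlDual K lam z₁ c (m + 1) =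
      ftrlDual K lam z₁ c m + (lam • ftrlIter K lam z₁ c m - c m) :=
  Finset.sum_range_succ _ _

lemma ftrlState_obj (m : ℕ) : (ftrlState K lam z₁ c m).obj = ftrlObj K lam z₁ c m := by
  induction m with
  | zero => ext; simp [ftrlState, FTRLState.init, ftrlObj]
  | succ m ih =>
    ext z
    rw [ftrlObj_succ]
    simp only [ftrlState, FTRLState.update, ih, ftrlState_n, proxWeight_strongRate]
    rfl

lemma ftrlIter_succ (m : ℕ) :
    ftrlIter K lam z₁ c (m + 1) = argminOn K (ftrlObj K lam z₁ c (m + 1)) := by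
  rw [← ftrlState_obj]
  rfl

lemma ftrlIter_congr {c' : ℕ → Vec k} {m : ℕ} (h : ∀ j < m, c j = c' j) :
    ftrlIter K lam z₁ c m = ftrlIter K lam z₁ c' m := by
  have hstate : ftrlState K lam z₁ c m = ftrlState K lam z₁ c' m := by
    induction m with
    | zero => rfl
    | succ m ih =>
      rw [ftrlState, ftrlState, ih fun j hj => h j (hj.trans m.lt_succ_self), h m m.lt_succ_self]
  rw [ftrlIter, hstate, ftrlIter]

lemma pFTRL_take_ofFn {T : ℕ} (msg : Fin T → Message k) {m : ℕ} (hm : m ≤ T) :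
    pFTRL K (strongRate lam) z₁ ((List.ofFn msg).take m) =
      ftrlIter K lam z₁ (fun j => if h : j < T then (msg ⟨j, h⟩).1 else 0) m := by
  have hstate : (((List.ofFn msg).take m).foldl (fun S m => S.update K (strongRate lam) m.1)
      (FTRLState.init z₁)) =
      ftrlState K lam z₁ (fun j => if h : j < T then (msg ⟨j, h⟩).1 else 0) m := by
    induction m with
    | zero => rfl
    | succ m ih =>
      rw [List.take_succ_eq_append_getElem (by simpa using hm), List.foldl_append,
        ih (Nat.le_of_succ_le hm), ftrlState]
      simp [show m < T from hm]
  rw [pFTRL, hstate, ftrlIter]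

lemma continuous_ftrlObj (m : ℕ) : Continuous (ftrlObj K lam z₁ c m) := by
  unfold ftrlObj
  fun_prop

lemma ftrlIter_mem_and_isMinOn (hK : IsCompact K) (hz₁ : z₁ ∈ K) (m : ℕ) :
    ftrlIter K lam z₁ c m ∈ K ∧ IsMinOn (ftrlObj K lam z₁ c m) K (ftrlIter K lam z₁ c m) := by
  cases m with
  | zero => exact ⟨hz₁, fun z _ => by simp [ftrlObj]⟩
  | succ m =>
    rw [ftrlIter_succ]
    exact Classical.epsilon_spec
      (hK.exists_isMinOn ⟨z₁, hz₁⟩ (continuous_ftrlObj (m + 1)).continuousOn)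

lemma ftrlIter_mem (hK : IsCompact K) (hz₁ : z₁ ∈ K) (m : ℕ) : ftrlIter K lam z₁ c m ∈ K :=
  (ftrlIter_mem_and_isMinOn hK hz₁ m).1

lemma isMinOn_ftrlIter (hK : IsCompact K) (hz₁ : z₁ ∈ K) (m : ℕ) :
    IsMinOn (ftrlObj K lam z₁ c m) K (ftrlIter K lam z₁ c m) :=
  (ftrlIter_mem_and_isMinOn hK hz₁ m).2

lemma ftrlObj_eq_add (m : ℕ) (x y : Vec k) :
    ftrlObj K lam z₁ c m y = ftrlObj K lam z₁ c m x +
      inner ℝ ((m * lam) • x - ftrlDual K lam z₁ c m) (y - x) + m * lam / 2 * ‖y - x‖ ^ 2 := by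
  induction m with
  | zero => simp [ftrlObj, ftrlDual]
  | succ m ih =>
    have hsq : ‖ftrlIter K lam z₁ c m - y‖ ^ 2 = ‖ftrlIter K lam z₁ c m - x‖ ^ 2
        - 2 * inner ℝ (ftrlIter K lam z₁ c m - x) (y - x) + ‖y - x‖ ^ 2 := by
      rw [← norm_sub_sq_real, sub_sub_sub_cancel_right]
    rw [ftrlObj_succ, ftrlObj_succ, ih, hsq, ftrlDual_succ]
    simp only [inner_sub_left, inner_sub_right, inner_add_left, inner_smul_left,
      RCLike.conj_to_real]
    push_cast
    ring

lemma inner_ftrlIter_nonneg (hK : IsCompact K) (hconv : Convex ℝ K) (hz₁ : z₁ ∈ K) (m : ℕ)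
    {y : Vec k} (hy : y ∈ K) :
    0 ≤ inner ℝ ((m * lam) • ftrlIter K lam z₁ c m - ftrlDual K lam z₁ c m)
      (y - ftrlIter K lam z₁ c m) := by
  refine inner_nonneg_of_forall_le_add_sq hconv (ftrlIter_mem hK hz₁ m) (fun z hz => ?_) hy
    (μ := m * lam / 2)
  have hmin := isMinOn_ftrlIter hK hz₁ m hz (lam := lam) (c := c)
  rw [Set.mem_ofPred_eq, ftrlObj_eq_add m (ftrlIter K lam z₁ c m) z] at hmin
  linarith

lemma ftrlObj_add_sq_le (hK : IsCompact K) (hconv : Convex ℝ K) (hz₁ : z₁ ∈ K) (m : ℕ)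
    {y : Vec k} (hy : y ∈ K) :
    ftrlObj K lam z₁ c m (ftrlIter K lam z₁ c m) +
      m * lam / 2 * ‖y - ftrlIter K lam z₁ c m‖ ^ 2 ≤ ftrlObj K lam z₁ c m y := by
  rw [ftrlObj_eq_add m (ftrlIter K lam z₁ c m) y]
  linarith [inner_ftrlIter_nonneg (lam := lam) (c := c) hK hconv hz₁ m hy]

lemma sum_inner_ftrlIter_le (hK : IsCompact K) (hconv : Convex ℝ K) (hlam : 0 < lam)
    (hz₁ : z₁ ∈ K) (m : ℕ) :
    ∑ j ∈ Finset.range m, (inner ℝ (c j) (ftrlIter K lam z₁ c j) - ‖c j‖ ^ 2 / (2 * (j + 1) * lam))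
      ≤ ftrlObj K lam z₁ c m (ftrlIter K lam z₁ c m) := by
  induction m with
  | zero => simp [ftrlObj]
  | succ m ih =>
    rw [Finset.sum_range_succ, ftrlObj_succ]
    have hgrowth := ftrlObj_add_sq_le (lam := lam) (c := c) hK hconv hz₁ m
      (ftrlIter_mem (c := c) (lam := lam) hK hz₁ (m + 1))
    set x := ftrlIter K lam z₁ c m
    set y := ftrlIter K lam z₁ c (m + 1)
    have hinner : inner ℝ (c m) x - inner ℝ (c m) y ≤ ‖c m‖ * ‖y - x‖ := by
      rw [← inner_sub_right, norm_sub_rev]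
      exact real_inner_le_norm _ _
    have hyoung : ‖c m‖ * ‖y - x‖ ≤
        ‖c m‖ ^ 2 / (2 * (m + 1) * lam) + (m + 1) * lam / 2 * ‖y - x‖ ^ 2 := by
      rw [← sub_nonneg]
      calc (0 : ℝ) ≤ ((m + 1) * lam * ‖y - x‖ - ‖c m‖) ^ 2 / (2 * (m + 1) * lam) := by positivity
        _ = _ := by field_simp; ring
    rw [norm_sub_rev x y]
    linarith

lemma ftrl_regret_le (hK : IsCompact K) (hconv : Convex ℝ K) (hlam : 0 < lam)
    (hz₁ : z₁ ∈ K) (m : ℕ) {v : Vec k} (hv : v ∈ K) :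
    ∑ j ∈ Finset.range m, (inner ℝ (c j) (ftrlIter K lam z₁ c j - v) -
        lam / 2 * ‖ftrlIter K lam z₁ c j - v‖ ^ 2) ≤
      ∑ j ∈ Finset.range m, ‖c j‖ ^ 2 / (2 * (j + 1) * lam) := by
  have hle := (sum_inner_ftrlIter_le (c := c) hK hconv hlam hz₁ m).trans
    (isMinOn_ftrlIter hK hz₁ m hv)
  rw [ftrlObj, ← sub_nonpos, ← Finset.sum_sub_distrib] at hle
  rw [← sub_nonpos, ← Finset.sum_sub_distrib]
  refine le_of_eq_of_le (Finset.sum_congr rfl fun j _ => ?_) hle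
  rw [inner_sub_right]
  ring

lemma ftrlDual_sub_smul {n m : ℕ} (hnm : n ≤ m) (x : Vec k) :
    ftrlDual K lam z₁ c m - (ftrlDual K lam z₁ c n + ((m - n) * lam) • x) =
      ∑ j ∈ Finset.Ico n m, lam • (ftrlIter K lam z₁ c j - x) - ∑ j ∈ Finset.Ico n m, c j := by
  simp only [ftrlDual, smul_sub, Finset.sum_sub_distrib, Finset.sum_const, Nat.card_Ico,
    ← Finset.sum_range_add_sum_Ico _ hnm, ← Nat.cast_smul_eq_nsmul ℝ, Nat.cast_sub hnm, mul_smul]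
  abel

lemma mul_norm_ftrlIter_sub_le (hK : IsCompact K) (hconv : Convex ℝ K) (hlam : 0 ≤ lam)
    (hz₁ : z₁ ∈ K) {n m : ℕ} (hnm : n ≤ m) :
    m * lam * ‖ftrlIter K lam z₁ c m - ftrlIter K lam z₁ c n‖ ≤
      ‖∑ j ∈ Finset.Ico n m, c j‖ +
        lam * ∑ j ∈ Finset.Ico n m, ‖ftrlIter K lam z₁ c j - ftrlIter K lam z₁ c n‖ := by
  have hm := inner_ftrlIter_nonneg (c := c) (lam := lam) hK hconv hz₁ m
    (ftrlIter_mem (c := c) (lam := lam) hK hz₁ n)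
  have hn := inner_ftrlIter_nonneg (c := c) (lam := lam) hK hconv hz₁ n
    (ftrlIter_mem (c := c) (lam := lam) hK hz₁ m)
  set x := ftrlIter K lam z₁ c n
  have hshift : (n * lam) • x - ftrlDual K lam z₁ c n =
      (m * lam) • x - (ftrlDual K lam z₁ c n + ((m - n) * lam) • x) := by module
  rw [hshift] at hn
  refine (mul_norm_sub_le_of_inner_nonneg hm hn).trans ?_
  rw [ftrlDual_sub_smul hnm, Finset.mul_sum, add_comm]
  refine (norm_sub_le _ _).trans (add_le_add_left (norm_sum_le_of_le _ fun j _ => ?_) _)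
  rw [norm_smul, Real.norm_of_nonneg hlam]

lemma mul_norm_ftrlIter_sub_ftrlIter_le (hK : IsCompact K) (hconv : Convex ℝ K) (hz₁ : z₁ ∈ K)
    (c c' : ℕ → Vec k) (m : ℕ) :
    m * lam * ‖ftrlIter K lam z₁ c m - ftrlIter K lam z₁ c' m‖ ≤
      ‖ftrlDual K lam z₁ c m - ftrlDual K lam z₁ c' m‖ :=
  mul_norm_sub_le_of_inner_nonneg
    (inner_ftrlIter_nonneg hK hconv hz₁ m (ftrlIter_mem hK hz₁ m))
    (inner_ftrlIter_nonneg hK hconv hz₁ m (ftrlIter_mem hK hz₁ m))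

lemma continuous_ftrlIter {X : Type*} [TopologicalSpace X] (hK : IsCompact K)
    (hconv : Convex ℝ K) (hlam : 0 < lam) (hz₁ : z₁ ∈ K) {c : X → ℕ → Vec k} (m : ℕ)
    (hc : ∀ j < m, Continuous fun u => c u j) :
    Continuous fun u => ftrlIter K lam z₁ (c u) m := by
  induction m using Nat.strong_induction_on with
  | _ m ih =>
  rcases Nat.eq_zero_or_pos m with rfl | _
  · exact continuous_const
  have hdual : Continuous fun u => ftrlDual K lam z₁ (c u) m :=
    continuous_finsetSum _ fun j hj => by
      have hjm := Finset.mem_range.1 hj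
      exact ((ih j hjm fun i hi => hc i (hi.trans hjm)).const_smul lam).sub (hc j hjm)
  refine continuous_iff_continuousAt.2 fun u₀ => tendsto_iff_norm_sub_tendsto_zero.2 ?_
  have hlim : Filter.Tendsto (fun u => ‖ftrlDual K lam z₁ (c u) m - ftrlDual K lam z₁ (c u₀) m‖ /
      (m * lam)) (nhds u₀) (nhds 0) :=
    Continuous.tendsto' (by fun_prop) _ _ (by simp)
  refine squeeze_zero (fun _ => norm_nonneg _) (fun u => ?_) hlim
  rw [le_div_iff₀ (by positivity), mul_comm]
  exact mul_norm_ftrlIter_sub_ftrlIter_le hK hconv hz₁ (c u) (c u₀) m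

end FTRL

/-! ### Ranks of observations -/

namespace LatencyModel

variable {T : ℕ} (τ : LatencyModel T)

/-- The permutation listing the rounds by increasing feedback time. -/
noncomputable def obsPerm : Equiv.Perm (Fin T) := Tuple.sort τ.r

/-- The number of observations made before the observation of round `s`. -/
noncomputable def rank (s : Fin T) : ℕ := τ.obsPerm.symm s

/-- The number of observations made before the prediction of round `t`. -/
noncomputable def seen (t : Fin T) : ℕ := (Finset.univ.filter fun s => τ.r s < τ.l t).card

lemma strictMono_r_obsPerm : StrictMono (τ.r ∘ τ.obsPerm) :=
  (Tuple.monotone_sort τ.r).strictMono_of_injective (τ.r_injective.comp τ.obsPerm.injective)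

lemma rank_lt (s : Fin T) : τ.rank s < T := (τ.obsPerm.symm s).2

lemma rank_obsPerm (j : Fin T) : τ.rank (τ.obsPerm j) = j := by simp [rank]

lemma obsPerm_rank (s : Fin T) : τ.obsPerm ⟨τ.rank s, τ.rank_lt s⟩ = s := by simp [rank]

lemma rank_injective : Function.Injective τ.rank :=
  Fin.val_injective.comp τ.obsPerm.symm.injective

lemma lt_rank_iff (j s : Fin T) : (j : ℕ) < τ.rank s ↔ τ.r (τ.obsPerm j) < τ.r s := by
  conv_rhs => rw [← τ.obsPerm_rank s]
  exact (τ.strictMono_r_obsPerm.lt_iff_lt (a := j) (b := ⟨τ.rank s, τ.rank_lt s⟩)).symm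

lemma rank_lt_rank_iff (s t : Fin T) : τ.rank s < τ.rank t ↔ τ.r s < τ.r t := by
  simpa [rank] using τ.lt_rank_iff (τ.obsPerm.symm s) t

lemma card_filter_comp_obsPerm (p : Fin T → Prop) [DecidablePred p] :
    (Finset.univ.filter fun j => p (τ.obsPerm j)).card = (Finset.univ.filter p).card :=
  Finset.card_equiv τ.obsPerm (by simp)

lemma lt_seen_iff (j t : Fin T) : (j : ℕ) < τ.seen t ↔ τ.r (τ.obsPerm j) < τ.l t := by
  rw [seen, ← τ.card_filter_comp_obsPerm]
  exact Tuple.lt_card_lt_iff_apply_lt_of_monotone τ.strictMono_r_obsPerm.monotone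

lemma rank_lt_seen_iff (s t : Fin T) : τ.rank s < τ.seen t ↔ τ.r s < τ.l t := by
  simpa [rank] using τ.lt_seen_iff (τ.obsPerm.symm s) t

lemma lt_of_rank_lt_seen {s t : Fin T} (h : τ.rank s < τ.seen t) : s < t :=
  τ.l_strictMono.lt_iff_lt.1 ((τ.l_lt_r s).trans ((τ.rank_lt_seen_iff s t).1 h))

lemma seen_le (t : Fin T) : τ.seen t ≤ T :=
  (Finset.card_le_univ _).trans_eq (Fintype.card_fin T)

lemma rank_eq_card (s : Fin T) :
    τ.rank s = (Finset.univ.filter fun s' => τ.r s' < τ.r s).card := by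
  simp only [← τ.card_filter_comp_obsPerm fun s' => τ.r s' < τ.r s, ← lt_rank_iff,
    Fin.card_filter_val_lt, min_eq_right (τ.rank_lt s).le]

lemma seen_add_dualDelay (s : Fin T) : τ.seen s + τ.dualDelay s = τ.rank s := by
  have hdisj : Disjoint (Finset.univ.filter fun t => τ.r t < τ.l s)
      (Finset.univ.filter fun t => τ.l s < τ.r t ∧ τ.r t < τ.r s) :=
    Finset.disjoint_filter.2 fun _ _ hlt hgt => lt_asymm hlt hgt.1
  rw [rank_eq_card, seen, dualDelay, ← Finset.card_union_of_disjoint hdisj, ← Finset.filter_or]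
  congr 1
  refine Finset.filter_congr fun t _ => ⟨?_, fun h => ?_⟩
  · rintro (h | h)
    exacts [h.trans (τ.l_lt_r s), h.2]
  · exact (τ.l_ne_r s t).symm.lt_or_gt.imp_right fun hlt => ⟨hlt, h⟩

lemma seen_le_rank (s : Fin T) : τ.seen s ≤ τ.rank s :=
  (Nat.le_add_right _ _).trans_eq (τ.seen_add_dualDelay s)

lemma dualDelay_le_rank (s : Fin T) : τ.dualDelay s ≤ τ.rank s :=
  (Nat.le_add_left _ _).trans_eq (τ.seen_add_dualDelay s)

lemma card_filter_l_lt_r (s : Fin T) :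
    (Finset.univ.filter fun t => τ.l t < τ.r s).card = s + τ.delay s + 1 := by
  have hdisj : Disjoint (Finset.univ.filter fun t => t ≤ s)
      (Finset.univ.filter fun t => τ.l s < τ.l t ∧ τ.l t < τ.r s) :=
    Finset.disjoint_filter.2 fun _ _ hle hlt => (τ.l_strictMono.lt_iff_lt.1 hlt.1).not_ge hle
  have hunion : (Finset.univ.filter fun t => τ.l t < τ.r s) = (Finset.univ.filter fun t =>
      t ≤ s) ∪ Finset.univ.filter fun t => τ.l s < τ.l t ∧ τ.l t < τ.r s := by
    rw [← Finset.filter_or]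
    refine Finset.filter_congr fun t _ => ⟨fun h => ?_, ?_⟩
    · exact (le_or_gt t s).imp_right fun hlt => ⟨τ.l_strictMono hlt, h⟩
    · rintro (h | h)
      exacts [(τ.l_strictMono.monotone h).trans_lt (τ.l_lt_r s), h.2]
  rw [hunion, Finset.card_union_of_disjoint hdisj, Finset.filter_ge_eq_Iic, Fin.card_Iic, delay]
  ring

lemma le_add_delay_iff (s t : Fin T) : (t : ℕ) ≤ s + τ.delay s ↔ τ.l t < τ.r s := by
  rw [← Nat.lt_succ_iff, Nat.succ_eq_add_one, ← card_filter_l_lt_r]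
  exact Tuple.lt_card_lt_iff_apply_lt_of_monotone τ.l_strictMono.monotone

lemma add_delay_lt (s : Fin T) : s + τ.delay s < T := by
  rw [← Nat.succ_le_iff, Nat.succ_eq_add_one, ← card_filter_l_lt_r]
  exact (Finset.card_le_univ _).trans_eq (Fintype.card_fin T)

lemma add_delay_lt_iff (s t : Fin T) : s + τ.delay s < (t : ℕ) ↔ τ.r s < τ.l t := by
  rw [← not_le, le_add_delay_iff, not_lt, (τ.l_ne_r t s).symm.le_iff_lt]

/-- The round at whose end the feedback of round `s` arrives. -/
noncomputable def arrivalRound (s : Fin T) : Fin T := ⟨s + τ.delay s, τ.add_delay_lt s⟩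

lemma le_arrivalRound_iff {s t : Fin T} : t ≤ τ.arrivalRound s ↔ τ.l t < τ.r s :=
  τ.le_add_delay_iff s t

lemma add_delay_mono {s t : Fin T} (h : τ.r s ≤ τ.r t) :
    (s : ℕ) + τ.delay s ≤ t + τ.delay t :=
  τ.le_arrivalRound_iff.2 ((τ.le_arrivalRound_iff.1 (le_refl (τ.arrivalRound s))).trans_le h)

lemma obsOrder_perm : τ.obsOrder.Perm (List.finRange T) := List.mergeSort_perm _ _

lemma pairwise_obsOrder : τ.obsOrder.Pairwise fun s t => τ.r s ≤ τ.r t := by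
  have hsorted := List.pairwise_mergeSort (le := fun s t => decide (τ.r s ≤ τ.r t))
    (by simpa using fun a b c => le_trans) (by simpa using fun a b => le_total _ _)
    (List.finRange T)
  simpa only [decide_eq_true_eq] using! hsorted

lemma obsOrder_eq_ofFn : τ.obsOrder = List.ofFn τ.obsPerm := by
  have hperm : (List.ofFn τ.obsPerm).Perm (List.finRange T) := by
    simpa [List.ofFn_id] using τ.obsPerm.ofFn_comp_perm id
  refine (τ.obsOrder_perm.trans hperm.symm).eq_of_pairwise (le := fun s t => τ.r s ≤ τ.r t)
    (fun s t _ _ hst hts => τ.r_injective (hst.antisymm hts)) τ.pairwise_obsOrder ?_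
  exact List.pairwise_ofFn.2 fun i j hij => (τ.strictMono_r_obsPerm hij).le

end LatencyModel

section ListFilter

variable {α : Type*}

lemma filter_key_le_eq_append {key : α → ℕ} {L : List α}
    (h : L.Pairwise fun a b => key a ≤ key b) (n : ℕ) :
    L.filter (fun a => decide (key a ≤ n)) =
      L.filter (fun a => decide (key a < n)) ++ L.filter (fun a => decide (key a = n)) := by
  induction L with
  | nil => rfl
  | cons a L ih =>
    rw [List.pairwise_cons] at h
    have ih := ih h.2
    rcases lt_trichotomy (key a) n with ha | ha | ha
    · simp [ha, ha.ne, ha.le, ih]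
    · have hnil : L.filter (fun a => decide (key a < n)) = [] :=
        List.filter_eq_nil_iff.2 fun b hb => by
          simpa only [decide_eq_true_eq, not_lt, ha] using h.1 b hb
      rw [hnil, List.nil_append] at ih
      simp [ha, hnil, ih]
    · simp [ha.ne', ha.not_ge, ha.not_gt, ih]

lemma filter_eq_take_countP {p : α → Bool} {L : List α}
    (h : L.Pairwise fun a b => p b → p a) : L.filter p = L.take (L.countP p) := by
  induction L with
  | nil => rfl
  | cons a L ih =>
    rw [List.pairwise_cons] at h
    by_cases ha : p a
    · simp [ha, ih h.2]
    · have hnot : ∀ b ∈ L, ¬ p b := fun b hb hpb => ha (h.1 b hb hpb)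
      simp [ha, List.filter_eq_nil_iff.2 hnot, List.countP_eq_zero.2 hnot]

end ListFilter

lemma LatencyModel.filter_obsOrder {T : ℕ} (τ : LatencyModel T) (t : Fin T) :
    τ.obsOrder.filter (fun s : Fin T => decide ((s : ℕ) + τ.delay s < (t : ℕ))) =
      τ.obsOrder.take (τ.seen t) := by
  have hcount : τ.obsOrder.countP (fun s : Fin T => decide ((s : ℕ) + τ.delay s < (t : ℕ))) =
      τ.seen t := by
    rw [τ.obsOrder_perm.countP_eq, List.countP_eq_length_filter, seen]
    simp only [add_delay_lt_iff]
    rfl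
  rw [filter_eq_take_countP, hcount]
  refine τ.pairwise_obsOrder.imp fun {a b} hab => ?_
  simpa only [decide_eq_true_eq] using (τ.add_delay_mono hab).trans_lt

section Unrolling

variable {k T : ℕ} (B : BaseAlgorithm k) (r : ℝ) (δ : ℕ → ℝ) (τ : LatencyModel T)
  (f : Fin T → Vec k → ℝ) (u : Fin T → UnitSphere k)

lemma wrapperState_succ {n : ℕ} (hn : n < T) : wrapperState B r δ τ f u (n + 1) =
    wrapperRound B r δ τ f u ⟨n, hn⟩ (wrapperState B r δ τ f u n) := by
  simp [wrapperState, hn]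

lemma pred_wrapperState (t : Fin T) {n : ℕ} (htn : (t : ℕ) < n) (hn : n ≤ T) :
    (wrapperState B r δ τ f u n).pred t =
      (1 - δ ((t : ℕ) + 1) / r) • B (wrapperState B r δ τ f u t).msgs +
        δ ((t : ℕ) + 1) • (u t : Vec k) := by
  induction n, htn using Nat.le_induction with
  | base =>
    rw [wrapperState_succ B r δ τ f u t.2]
    simp [wrapperRound]
  | succ n htn ih =>
    have hne : t ≠ ⟨n, hn⟩ := Fin.ne_of_val_ne (Nat.lt_of_succ_le htn).ne
    rw [wrapperState_succ B r δ τ f u hn, ← ih (Nat.le_of_succ_le hn)]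
    simp [wrapperRound, Function.update_of_ne hne]

lemma prediction_eq (t : Fin T) : prediction B r δ τ f u t =
      (1 - δ ((t : ℕ) + 1) / r) • B (wrapperState B r δ τ f u t).msgs +
        δ ((t : ℕ) + 1) • (u t : Vec k) :=
  pred_wrapperState B r δ τ f u t t.2 le_rfl

/-- The message sent to the base algorithm when the feedback of round `s` arrives. -/
noncomputable def message (s : Fin T) : Message k :=
  (((k : ℝ) / δ ((s : ℕ) + 1) * f s (prediction B r δ τ f u s)) • (u s : Vec k),
    τ.dualDelay s, τ.dualBacklog s)

lemma msgs_wrapperState_succ {n : ℕ} (hn : n < T) :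
    (wrapperState B r δ τ f u (n + 1)).msgs = (wrapperState B r δ τ f u n).msgs ++
      (τ.arrivals ⟨n, hn⟩).map (message B r δ τ f u) := by
  have harrivals : (wrapperState B r δ τ f u (n + 1)).msgs = (wrapperState B r δ τ f u n).msgs ++
      (τ.arrivals ⟨n, hn⟩).map fun s : Fin T =>
        ((((k : ℝ) / δ ((s : ℕ) + 1) * f s ((wrapperState B r δ τ f u (n + 1)).pred s)) •
          (u s : Vec k), τ.dualDelay s, τ.dualBacklog s) : Message k) := by
    rw [wrapperState_succ B r δ τ f u hn]
    rfl
  rw [harrivals]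
  congr 1
  refine List.map_congr_left fun s hs => ?_
  have hsn : (s : ℕ) + τ.delay s = n := of_decide_eq_true (List.mem_filter.1 hs).2
  rw [message, prediction_eq, pred_wrapperState B r δ τ f u s (by omega) hn]

lemma msgs_wrapperState {n : ℕ} (hn : n ≤ T) : (wrapperState B r δ τ f u n).msgs =
    (τ.obsOrder.filter (fun s : Fin T => decide ((s : ℕ) + τ.delay s < n))).map
      (message B r δ τ f u) := by
  induction n with
  | zero => simp [wrapperState]
  | succ n ih =>
    simp only [Nat.lt_add_one_iff]
    rw [msgs_wrapperState_succ B r δ τ f u hn, ih (Nat.le_of_succ_le hn),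
      filter_key_le_eq_append (key := fun s : Fin T => (s : ℕ) + τ.delay s)
        (τ.pairwise_obsOrder.imp τ.add_delay_mono), List.map_append, LatencyModel.arrivals]

lemma prediction_eq_take (t : Fin T) : prediction B r δ τ f u t =
      (1 - δ ((t : ℕ) + 1) / r) •
        B ((List.ofFn fun j => message B r δ τ f u (τ.obsPerm j)).take (τ.seen t)) +
        δ ((t : ℕ) + 1) • (u t : Vec k) := by
  rw [prediction_eq, msgs_wrapperState _ _ _ _ _ _ t.2.le, τ.filter_obsOrder, List.map_take,
    τ.obsOrder_eq_ofFn, List.map_ofFn]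
  rfl

end Unrolling

namespace LatencyModel

variable {T : ℕ} (τ : LatencyModel T)

lemma dualBacklog_le_backlog_arrivalRound (s : Fin T) :
    τ.dualBacklog s ≤ τ.backlog (τ.arrivalRound s) := by
  set t := τ.arrivalRound s
  have hlt : τ.l t < τ.r s := τ.le_arrivalRound_iff.1 le_rfl
  rw [← Nat.succ_le_succ_iff]
  calc τ.dualBacklog s + 1
      = (insert s (Finset.univ.filter fun s' => τ.l s' < τ.r s ∧ τ.r s < τ.r s')).card :=
        (Finset.card_insert_of_notMem (by simp)).symm
    _ ≤ (insert t (Finset.univ.filter fun s' => τ.l s' < τ.l t ∧ τ.l t < τ.r s')).card := by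
        refine Finset.card_le_card fun s' hs' => ?_
        have hs' : τ.l s' < τ.r s ∧ τ.r s ≤ τ.r s' := by
          rcases Finset.mem_insert.1 hs' with rfl | hs'
          · exact ⟨τ.l_lt_r s', le_rfl⟩
          · exact (Finset.mem_filter.1 hs').2.imp_right le_of_lt
        rw [Finset.mem_insert, Finset.mem_filter]
        exact (τ.le_arrivalRound_iff.2 hs'.1).eq_or_lt.imp_right fun hs't =>
          ⟨Finset.mem_univ _, τ.l_strictMono hs't, hlt.trans_le hs'.2⟩
    _ ≤ τ.backlog t + 1 := Finset.card_insert_le _ _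

lemma dualBacklog_le_maxBacklog (s : Fin T) : τ.dualBacklog s ≤ τ.maxBacklog :=
  (τ.dualBacklog_le_backlog_arrivalRound s).trans (Finset.le_sup (Finset.mem_univ _))

lemma sum_dualDelay : ∑ t, τ.dualDelay t = τ.totalDelay := by
  let dual (s t : Fin T) : ℕ := if τ.l t < τ.r s ∧ τ.r s < τ.r t then 1 else 0
  let primal (s t : Fin T) : ℕ := if τ.l t < τ.l s ∧ τ.l s < τ.r t then 1 else 0
  have hpair (s t : Fin T) : dual s t + dual t s = primal s t + primal t s := by
    rcases eq_or_ne s t with rfl | hne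
    · simp [dual, primal]
    have := τ.l_lt_r s
    have := τ.l_lt_r t
    have := τ.r_injective.ne hne
    have := τ.l_strictMono.injective.ne hne
    have := τ.l_ne_r s t
    have := τ.l_ne_r t s
    grind
  have hsum : ∑ t, ∑ s, (dual s t + dual t s) = ∑ t, ∑ s, (primal s t + primal t s) := by
    simp only [hpair]
  simp only [Finset.sum_add_distrib] at hsum
  rw [Finset.sum_comm (f := fun t s => dual t s),
    Finset.sum_comm (f := fun t s => primal t s)] at hsum
  simp only [totalDelay, dualDelay, delay, Finset.card_filter]
  change ∑ t, ∑ s, dual s t = ∑ t, ∑ s, primal s t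
  omega

lemma sum_comp_rank {M : Type*} [AddCommMonoid M] (F : ℕ → M) :
    ∑ s, F (τ.rank s) = ∑ j ∈ Finset.range T, F j := by
  rw [Finset.sum_range, ← Equiv.sum_comp τ.obsPerm]
  simp only [rank_obsPerm]

lemma sum_dualDelay_div_le_maxBacklog :
    ∑ s, (τ.dualDelay s : ℝ) / (τ.rank s + 1) ≤
      τ.maxBacklog * ∑ j ∈ Finset.range T, 1 / ((j : ℝ) + 1) := by
  calc ∑ s, (τ.dualDelay s : ℝ) / (τ.rank s + 1)
      = ∑ s, ∑ t with τ.l s < τ.r t ∧ τ.r t < τ.r s, 1 / ((τ.rank s : ℝ) + 1) := by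
        simp only [dualDelay, Finset.sum_const, nsmul_eq_mul, mul_one_div]
    _ ≤ ∑ s, ∑ t with τ.l s < τ.r t ∧ τ.r t < τ.r s, 1 / ((τ.rank t : ℝ) + 1) := by
        gcongr with s _ t ht
        exact ((τ.rank_lt_rank_iff t s).2 (Finset.mem_filter.1 ht).2.2).le
    _ = ∑ t, ∑ s with τ.l s < τ.r t ∧ τ.r t < τ.r s, 1 / ((τ.rank t : ℝ) + 1) :=
        Finset.sum_comm' (by simp)
    _ = ∑ t, τ.dualBacklog t * (1 / ((τ.rank t : ℝ) + 1)) := by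
        simp only [dualBacklog, Finset.sum_const, nsmul_eq_mul]
    _ ≤ ∑ t, τ.maxBacklog * (1 / ((τ.rank t : ℝ) + 1)) := by
        gcongr with t _
        exact τ.dualBacklog_le_maxBacklog t
    _ = _ := by
        rw [← Finset.mul_sum, τ.sum_comp_rank fun j => 1 / ((j : ℝ) + 1)]

end LatencyModel

lemma sum_range_ite_add_one_le {X : ℝ} (hX : 0 ≤ X) (n : ℕ) :
    ∑ j ∈ Finset.range n, (if (j : ℝ) + 1 ≤ X then (1 : ℝ) else 0) ≤ X := by
  rw [Finset.sum_boole]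
  calc _ ≤ (((Finset.range ⌊X⌋₊).card : ℕ) : ℝ) := by
        refine Nat.cast_le.2 (Finset.card_le_card fun j hj => Finset.mem_range.2 ?_)
        exact Nat.le_floor (by exact_mod_cast (Finset.mem_filter.1 hj).2)
    _ ≤ X := by
        rw [Finset.card_range]
        exact Nat.floor_le hX

lemma sum_range_one_div_le_log {n : ℕ} (hn : 2 ≤ n) :
    ∑ j ∈ Finset.range n, 1 / ((j : ℝ) + 1) ≤ 3 * Real.log n := by
  have hharmonic := harmonic_le_one_add_log n
  have hcast : ((harmonic n : ℚ) : ℝ) = ∑ j ∈ Finset.range n, 1 / ((j : ℝ) + 1) := by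
    simp [harmonic]
  have hlog : Real.log 2 ≤ Real.log n := Real.log_le_log (by norm_num) (by exact_mod_cast hn)
  rw [hcast] at hharmonic
  linarith [Real.log_two_gt_d9]

namespace LatencyModel

variable {T : ℕ} (τ : LatencyModel T)

lemma sum_dualDelay_div_le_sqrt :
    ∑ s, (τ.dualDelay s : ℝ) / (τ.rank s + 1) ≤ 2 * √(τ.totalDelay : ℝ) := by
  rcases Nat.eq_zero_or_pos τ.totalDelay with hzero | hpos
  · have hdual : ∀ s ∈ Finset.univ, τ.dualDelay s = 0 := by
      rwa [← sum_dualDelay, Finset.sum_eq_zero_iff] at hzero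
    rw [Finset.sum_eq_zero fun s hs => by rw [hdual s hs, Nat.cast_zero, zero_div]]
    positivity
  set X := √(τ.totalDelay : ℝ) with hX
  have hX0 : 0 < X := Real.sqrt_pos.2 (Nat.cast_pos.2 hpos)
  have hterm (s : Fin T) : (τ.dualDelay s : ℝ) / (τ.rank s + 1) ≤
      (if (τ.rank s : ℝ) + 1 ≤ X then 1 else 0) + τ.dualDelay s / X := by
    have hrank : (τ.dualDelay s : ℝ) ≤ τ.rank s := Nat.cast_le.2 (τ.dualDelay_le_rank s)
    split_ifs with h
    · have : (τ.dualDelay s : ℝ) / (τ.rank s + 1) ≤ 1 := by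
        rw [div_le_one (by positivity)]
        linarith
      linarith [div_nonneg (Nat.cast_nonneg (α := ℝ) (τ.dualDelay s)) hX0.le]
    · rw [zero_add]
      exact div_le_div_of_nonneg_left (by positivity) hX0 (not_le.1 h).le
  have hsum : ∑ s, (τ.dualDelay s : ℝ) / X = X := by
    rw [← Finset.sum_div, ← Nat.cast_sum, sum_dualDelay, hX, Real.div_sqrt]
  calc _ ≤ ∑ s, ((if (τ.rank s : ℝ) + 1 ≤ X then 1 else 0) + τ.dualDelay s / X) :=
        Finset.sum_le_sum fun s _ => hterm s
    _ ≤ X + X := by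
        rw [Finset.sum_add_distrib, hsum,
          τ.sum_comp_rank fun j => if (j : ℝ) + 1 ≤ X then (1 : ℝ) else 0]
        gcongr
        exact sum_range_ite_add_one_le hX0.le T
    _ = _ := (two_mul X).symm

lemma sum_dualDelay_div_le (hT : 2 ≤ T) :
    ∑ s, (τ.dualDelay s : ℝ) / (τ.rank s + 1) ≤
      3 * min (τ.maxBacklog * Real.log T) (√(τ.totalDelay : ℝ)) := by
  rw [mul_min_of_nonneg _ _ zero_le_three, le_min_iff]
  constructor
  · calc _ ≤ τ.maxBacklog * ∑ j ∈ Finset.range T, 1 / ((j : ℝ) + 1) :=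
          τ.sum_dualDelay_div_le_maxBacklog
      _ ≤ τ.maxBacklog * (3 * Real.log T) := by gcongr; exact sum_range_one_div_le_log hT
      _ = _ := by ring
  · exact τ.sum_dualDelay_div_le_sqrt.trans (by gcongr; norm_num)

end LatencyModel

section Resampling

variable {ι : Type*} [Fintype ι] [DecidableEq ι] {X : ι → Type*} [∀ i, MeasurableSpace (X i)]
  (μ : ∀ i, Measure (X i)) [∀ i, SigmaFinite (μ i)] (s : ι) [IsProbabilityMeasure (μ s)]

lemma measurePreserving_update_pi :
    MeasurePreserving (fun p : (∀ i, X i) × X s => Function.update p.1 s p.2)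
      ((Measure.pi μ).prod (μ s)) (Measure.pi μ) := by
  refine ⟨measurable_update', (Measure.pi_eq fun A hA => ?_).symm⟩
  have hpre : (fun p : (∀ i, X i) × X s => Function.update p.1 s p.2) ⁻¹' Set.univ.pi A =
      Set.univ.pi (Function.update A s Set.univ) ×ˢ A s := by
    ext p
    simp only [Set.mem_preimage, Set.mem_univ_pi, Set.mem_prod]
    constructor
    · refine fun h => ⟨fun i => ?_, by simpa using h s⟩
      rcases eq_or_ne i s with rfl | hi
      · simp
      · simpa [hi] using h i
    · rintro ⟨hfst, hsnd⟩ i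
      rcases eq_or_ne i s with rfl | hi
      · simpa using hsnd
      · simpa [hi] using hfst i
  rw [Measure.map_apply measurable_update' (MeasurableSet.univ_pi hA), hpre, Measure.prod_prod,
    Measure.pi_pi, ← Finset.prod_erase_mul _ _ (Finset.mem_univ s),
    ← Finset.prod_erase_mul _ _ (Finset.mem_univ s), Function.update_self, measure_univ, mul_one]
  congr 1
  exact Finset.prod_congr rfl fun i hi => by rw [Function.update_of_ne (Finset.ne_of_mem_erase hi)]

lemma integral_pi_eq_integral_integral_update {E : Type*} [NormedAddCommGroup E] [NormedSpace ℝ E]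
    {F : (∀ i, X i) → E} (hF : Integrable F (Measure.pi μ)) :
    ∫ u, F u ∂Measure.pi μ = ∫ u, ∫ v, F (Function.update u s v) ∂μ s ∂Measure.pi μ := by
  have hupdate := measurePreserving_update_pi μ s
  rw [← hupdate.map_eq] at hF
  conv_lhs => rw [← hupdate.map_eq]
  rw [integral_map hupdate.aemeasurable hF.aestronglyMeasurable]
  exact integral_prod _ (hF.comp_measurable hupdate.measurable)

end Resampling

/-! ### The wrapper around P-FTRL -/

open scoped Pointwise in
lemma closedBall_one_sub_smul_subset {E : Type*} [NormedAddCommGroup E] [NormedSpace ℝ E]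
    {K : Set E} (hK : Convex ℝ K) {r δ : ℝ} (hr : 0 < r) (hrK : Metric.closedBall 0 r ⊆ K)
    (hδ : 0 ≤ δ) (hδr : δ ≤ r) {z : E} (hz : z ∈ K) :
    Metric.closedBall ((1 - δ / r) • z) δ ⊆ K := by
  intro p hp
  have hoffset : p - (1 - δ / r) • z ∈ (δ / r) • Metric.closedBall (0 : E) r := by
    rwa [smul_closedBall _ _ hr.le, smul_zero, Real.norm_of_nonneg (by positivity),
      div_mul_cancel₀ _ hr.ne', mem_closedBall_zero_iff, ← dist_eq_norm]
  obtain ⟨y, hy, hyp⟩ := hoffset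
  rw [← add_sub_cancel ((1 - δ / r) • z) p, ← hyp]
  exact hK hz (hrK hy) (sub_nonneg.2 ((div_le_one hr).2 hδr)) (by positivity) (by ring)

/-- A bandit problem with delays together with the parameters of the wrapper around P-FTRL. The
differentiability of the losses `f t` is replaced by a choice of subgradients `g t`. -/
structure Setting (k T : ℕ) where
  K : Set (Vec k)
  r : ℝ
  G : ℝ
  M : ℝ
  lam : ℝ
  z₁ : Vec k
  δ : ℕ → ℝ
  τ : LatencyModel T
  f : Fin T → Vec k → ℝ
  g : Fin T → Vec k → Vec k
  isCompact : IsCompact K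
  convex : Convex ℝ K
  r_pos : 0 < r
  ball_subset : Metric.closedBall 0 r ⊆ K
  lam_pos : 0 < lam
  isStrongSubgradient : ∀ t, IsStrongSubgradient K G lam (f t) (g t)
  abs_le : ∀ t, ∀ x ∈ K, |f t x| ≤ M
  z₁_mem : z₁ ∈ K
  δ_pos : ∀ t : Fin T, 0 < δ (t + 1)
  δ_le : ∀ t : Fin T, δ (t + 1) ≤ r

namespace Setting

variable {k T : ℕ} (S : Setting k T) (u : Fin T → UnitSphere k)

/-- The prediction of the wrapper in round `t` as a function of the exploration directions. -/
noncomputable def pred (t : Fin T) : Vec k :=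
  prediction (pFTRL S.K (strongRate S.lam) S.z₁) S.r S.δ S.τ S.f u t

/-- The loss vector sent to P-FTRL for round `s`. -/
noncomputable def lossVec (s : Fin T) : Vec k :=
  ((k : ℝ) / S.δ (s + 1) * S.f s (S.pred u s)) • (u s : Vec k)

/-- The loss vectors in the order in which P-FTRL receives them, continued by zeros. -/
noncomputable def lossSeq (j : ℕ) : Vec k :=
  if h : j < T then S.lossVec u (S.τ.obsPerm ⟨j, h⟩) else 0

/-- The output of P-FTRL after `m` updates. -/
noncomputable def iter (m : ℕ) : Vec k :=
  ftrlIter S.K S.lam S.z₁ (S.lossSeq u) m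

/-- The center of the sphere of radius `δ_t` on which the prediction of round `t` lies. -/
noncomputable def center (t : Fin T) : Vec k :=
  (1 - S.δ (t + 1) / S.r) • S.iter u (S.τ.seen t)

lemma lossSeq_of_lt {j : ℕ} (hj : j < T) :
    S.lossSeq u j = S.lossVec u (S.τ.obsPerm ⟨j, hj⟩) :=
  dif_pos hj

lemma lossSeq_rank (s : Fin T) : S.lossSeq u (S.τ.rank s) = S.lossVec u s := by
  rw [lossSeq_of_lt _ _ (S.τ.rank_lt s), S.τ.obsPerm_rank]

lemma iter_mem (m : ℕ) : S.iter u m ∈ S.K :=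
  ftrlIter_mem S.isCompact S.z₁_mem m

lemma pred_eq (t : Fin T) : S.pred u t = S.center u t + S.δ (t + 1) • (u t : Vec k) := by
  rw [pred, prediction_eq_take, pFTRL_take_ofFn _ (S.τ.seen_le t)]
  rfl

lemma closedBall_center_subset (t : Fin T) :
    Metric.closedBall (S.center u t) (S.δ (t + 1)) ⊆ S.K :=
  closedBall_one_sub_smul_subset S.convex S.r_pos S.ball_subset (S.δ_pos t).le (S.δ_le t)
    (S.iter_mem u _)

lemma pred_mem_closedBall (t : Fin T) :
    S.pred u t ∈ Metric.closedBall (S.center u t) (S.δ (t + 1)) := by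
  rw [pred_eq]
  exact add_smul_mem_closedBall _ (S.δ_pos t).le _

lemma pred_mem (t : Fin T) : S.pred u t ∈ S.K :=
  S.closedBall_center_subset u t (S.pred_mem_closedBall u t)

lemma continuousOn_loss (t : Fin T) : ContinuousOn (S.f t) S.K :=
  (S.isStrongSubgradient t).continuousOn S.lam_pos.le

section Continuity

lemma continuous_iter_of_forall_pred {m : ℕ}
    (h : ∀ i, S.τ.rank i < m → Continuous fun u => S.pred u i) :
    Continuous fun u => S.iter u m := by
  refine continuous_ftrlIter S.isCompact S.convex S.lam_pos S.z₁_mem m fun j hj => ?_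
  unfold lossSeq
  split_ifs with hjT
  · have hpred := h (S.τ.obsPerm ⟨j, hjT⟩) (by rwa [S.τ.rank_obsPerm])
    have hloss := (S.continuousOn_loss (S.τ.obsPerm ⟨j, hjT⟩)).comp_continuous hpred
      fun u => S.pred_mem u _
    unfold lossVec
    fun_prop
  · exact continuous_const

lemma continuous_pred (t : Fin T) : Continuous fun u => S.pred u t := by
  induction t using WellFoundedLT.induction with
  | ind t ih =>
  have hiter := S.continuous_iter_of_forall_pred (m := S.τ.seen t) fun i hi =>
    ih i (S.τ.lt_of_rank_lt_seen hi)
  simp only [pred_eq, center]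
  fun_prop

lemma continuous_iter (m : ℕ) : Continuous fun u => S.iter u m :=
  S.continuous_iter_of_forall_pred fun i _ => S.continuous_pred i

lemma continuous_loss_pred (t : Fin T) : Continuous fun u => S.f t (S.pred u t) :=
  (S.continuousOn_loss t).comp_continuous (S.continuous_pred t) fun u => S.pred_mem u t

lemma continuous_lossVec (s : Fin T) : Continuous fun u => S.lossVec u s := by
  have := S.continuous_loss_pred s
  unfold lossVec
  fun_prop

lemma continuous_lossSeq (j : ℕ) : Continuous fun u => S.lossSeq u j := by
  unfold lossSeq
  split_ifs
  · exact S.continuous_lossVec _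
  · exact continuous_const

end Continuity

section Dependence

variable {u}

lemma iter_congr {u' : Fin T → UnitSphere k} {m : ℕ}
    (h : ∀ i, S.τ.rank i < m → S.lossVec u i = S.lossVec u' i) : S.iter u m = S.iter u' m := by
  refine ftrlIter_congr fun j hj => ?_
  unfold lossSeq
  split_ifs with hjT
  · exact h _ (by rwa [S.τ.rank_obsPerm])
  · rfl

lemma lossVec_update_of_ne {i s : Fin T} (his : i ≠ s) {v : UnitSphere k}
    (h : S.pred (Function.update u s v) i = S.pred u i) :
    S.lossVec (Function.update u s v) i = S.lossVec u i := by
  rw [lossVec, lossVec, h, Function.update_of_ne his]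

variable (u)

lemma pred_update_of_ne {s t : Fin T} (hts : t ≠ s) (h : S.τ.l t < S.τ.r s) (v : UnitSphere k) :
    S.pred (Function.update u s v) t = S.pred u t := by
  induction t using WellFoundedLT.induction with
  | ind t ih =>
  have hiter : S.iter (Function.update u s v) (S.τ.seen t) = S.iter u (S.τ.seen t) :=
    S.iter_congr fun i hi => by
      have hrl := (S.τ.rank_lt_seen_iff i t).1 hi
      have his : i ≠ s := by rintro rfl; exact lt_asymm h hrl
      exact S.lossVec_update_of_ne his (ih i (S.τ.lt_of_rank_lt_seen hi) his
        ((S.τ.l_lt_r i).trans (hrl.trans h)))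
  rw [pred_eq, pred_eq, center, center, hiter, Function.update_of_ne hts]

lemma lossVec_update_of_lt {i s : Fin T} (his : i < s) (v : UnitSphere k) :
    S.lossVec (Function.update u s v) i = S.lossVec u i :=
  S.lossVec_update_of_ne his.ne
    (S.pred_update_of_ne u his.ne ((S.τ.l_strictMono his).trans (S.τ.l_lt_r s)) v)

lemma iter_update {s : Fin T} {m : ℕ} (hm : m ≤ S.τ.rank s) (v : UnitSphere k) :
    S.iter (Function.update u s v) m = S.iter u m :=
  S.iter_congr fun i hi => by
    have hrr := (S.τ.rank_lt_rank_iff i s).1 (hi.trans_le hm)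
    have his : i ≠ s := by rintro rfl; exact lt_irrefl _ hrr
    exact S.lossVec_update_of_ne his (S.pred_update_of_ne u his ((S.τ.l_lt_r i).trans hrr) v)

lemma lossVec_update_self (s : Fin T) (v : UnitSphere k) :
    S.lossVec (Function.update u s v) s = ((k : ℝ) / S.δ (s + 1) *
      S.f s (S.center u s + S.δ (s + 1) • (v : Vec k))) • (v : Vec k) := by
  rw [lossVec, pred_eq, center, S.iter_update u (S.τ.seen_le_rank s), Function.update_self, center]

end Dependence

end Setting

/-! ### Orthogonality of the noise -/

lemma integral_norm_sum_sq_of_pairwise_orthogonal {Ω ι E : Type*} [MeasurableSpace Ω]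
    {μ : Measure Ω} [NormedAddCommGroup E] [InnerProductSpace ℝ E] {X : ι → Ω → E} {A : Finset ι}
    (hint : ∀ i ∈ A, ∀ j ∈ A, Integrable (fun ω => inner ℝ (X i ω) (X j ω)) μ)
    (horth : ∀ i ∈ A, ∀ j ∈ A, i ≠ j → ∫ ω, inner ℝ (X i ω) (X j ω) ∂μ = 0) :
    ∫ ω, ‖∑ i ∈ A, X i ω‖ ^ 2 ∂μ = ∑ i ∈ A, ∫ ω, ‖X i ω‖ ^ 2 ∂μ := by
  calc ∫ ω, ‖∑ i ∈ A, X i ω‖ ^ 2 ∂μ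
      = ∫ ω, ∑ i ∈ A, ∑ j ∈ A, inner ℝ (X j ω) (X i ω) ∂μ := by
        simp only [← real_inner_self_eq_norm_sq, inner_sum, sum_inner]
    _ = ∑ i ∈ A, ∑ j ∈ A, ∫ ω, inner ℝ (X j ω) (X i ω) ∂μ := by
        rw [integral_finsetSum _ fun i hi => integrable_finsetSum _ fun j hj => hint j hj i hi]
        exact Finset.sum_congr rfl fun i hi => integral_finsetSum _ fun j hj => hint j hj i hi
    _ = ∑ i ∈ A, ∫ ω, ‖X i ω‖ ^ 2 ∂μ := by
        refine Finset.sum_congr rfl fun i hi => ?_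
        rw [Finset.sum_eq_single_of_mem i hi fun j hj hji => horth j hj i hi hji]
        simp only [real_inner_self_eq_norm_sq]

lemma le_half_add_inv_mul_sq {a : ℝ} (ha : 0 < a) (x : ℝ) :
    x ≤ 1 / 2 * a + (2 * a)⁻¹ * x ^ 2 := by
  have hsq : 1 / 2 * a + (2 * a)⁻¹ * x ^ 2 - x = (x - a) ^ 2 / (2 * a) := by
    field_simp
    ring
  rw [← sub_nonneg, hsq]
  positivity

lemma le_div_of_mul_le_add_sum_Ico {a : ℕ → ℝ} {b lam : ℝ} (hlam : 0 < lam) {n m : ℕ}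
    (ha : a n = 0) (hnm : n < m)
    (h : ∀ j, n < j → j ≤ m → j * lam * a j ≤ b + lam * ∑ i ∈ Finset.Ico n j, a i) :
    a m ≤ b / (lam * (n + 1)) := by
  induction m using Nat.strong_induction_on with
  | _ m ih =>
  have hsum : ∑ j ∈ Finset.Ico n m, a j ≤ (m - n - 1) * (b / (lam * (n + 1))) := by
    rw [Finset.sum_eq_sum_Ico_succ_bot hnm, ha, zero_add]
    calc ∑ j ∈ Finset.Ico (n + 1) m, a j ≤ ∑ _j ∈ Finset.Ico (n + 1) m, b / (lam * (n + 1)) := by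
          refine Finset.sum_le_sum fun j hj => ?_
          rw [Finset.mem_Ico] at hj
          exact ih j hj.2 hj.1 fun i hni hij => h i hni (hij.trans hj.2.le)
      _ = (m - n - 1) * (b / (lam * (n + 1))) := by
          rw [Finset.sum_const, Nat.card_Ico, nsmul_eq_mul, Nat.cast_sub hnm]
          push_cast
          ring
  have : (0 : ℝ) < m := by exact_mod_cast (Nat.zero_le n).trans_lt hnm
  refine le_of_mul_le_mul_left ?_ (show 0 < m * lam by positivity)
  calc m * lam * a m ≤ b + lam * ∑ j ∈ Finset.Ico n m, a j := h m hnm le_rfl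
    _ ≤ b + lam * ((m - n - 1) * (b / (lam * (n + 1)))) := by gcongr
    _ = m * lam * (b / (lam * (n + 1))) := by
      field_simp
      ring

/-- The joint law of independent uniform exploration directions. -/
noncomputable abbrev dirLaw (k T : ℕ) : Measure (Fin T → UnitSphere k) :=
  Measure.pi fun _ : Fin T => unifSphere k

namespace Setting

variable {k T : ℕ} (S : Setting k T) (u : Fin T → UnitSphere k)

/-- The conditional mean of the loss vector of round `s` given the other directions. -/
noncomputable def mean (s : Fin T) : Vec k :=
  onePointGradient (S.f s) (S.center u s) (S.δ (s + 1))

/-- The centered loss vector of round `s`. -/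
noncomputable def noise (s : Fin T) : Vec k :=
  S.lossVec u s - S.mean u s

lemma integral_lossVec_update (s : Fin T) :
    ∫ v, S.lossVec (Function.update u s v) s ∂unifSphere k = S.mean u s := by
  simp only [lossVec_update_self, mean, onePointGradient]

lemma mean_update_of_lt {i j : Fin T} (hij : i < j) (v : UnitSphere k) :
    S.mean (Function.update u j v) i = S.mean u i := by
  simp only [← integral_lossVec_update, Function.update_comm hij.ne',
    S.lossVec_update_of_lt _ hij]

lemma noise_update_of_lt {i j : Fin T} (hij : i < j) (v : UnitSphere k) :
    S.noise (Function.update u j v) i = S.noise u i := by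
  rw [noise, S.lossVec_update_of_lt u hij, S.mean_update_of_lt u hij, noise]

lemma norm_lossVec_le (s : Fin T) : ‖S.lossVec u s‖ ≤ k * S.M / S.δ (s + 1) := by
  have hδ := S.δ_pos s
  calc ‖S.lossVec u s‖ = k / S.δ (s + 1) * |S.f s (S.pred u s)| := by
        rw [lossVec, norm_smul, norm_eq_of_mem_sphere, mul_one, norm_mul, Real.norm_eq_abs,
          Real.norm_eq_abs, abs_of_nonneg (by positivity)]
    _ ≤ k / S.δ (s + 1) * S.M := by
        gcongr
        exact S.abs_le s _ (S.pred_mem u s)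
    _ = k * S.M / S.δ (s + 1) := by ring

variable [NeZero k]

lemma continuous_mean (s : Fin T) : Continuous fun u => S.mean u s := by
  have hcont : Continuous (Function.uncurry fun (u : Fin T → UnitSphere k) (v : UnitSphere k) =>
      S.lossVec (Function.update u s v) s) :=
    (S.continuous_lossVec s).comp (continuous_fst.update s continuous_snd)
  simpa [integral_lossVec_update] using
    continuous_parametric_integral_of_continuous (μ := unifSphere k) hcont isCompact_univ

lemma continuous_noise (s : Fin T) : Continuous fun u => S.noise u s :=
  (S.continuous_lossVec s).sub (S.continuous_mean s)

lemma norm_mean_le (s : Fin T) : ‖S.mean u s‖ ≤ S.G :=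
  (S.isStrongSubgradient s).norm_onePointGradient_le S.lam_pos.le (S.δ_pos s)
    (S.closedBall_center_subset u s)

lemma norm_noise_le {V : ℝ} {s : Fin T} (hV : k * S.M / S.δ (s + 1) ≤ V) :
    ‖S.noise u s‖ ≤ 2 * V := by
  have hloss (u) : ‖S.lossVec u s‖ ≤ V := (S.norm_lossVec_le u s).trans hV
  have hmean : ‖S.mean u s‖ ≤ V := by
    simpa [integral_lossVec_update] using norm_integral_le_of_norm_le_const (μ := unifSphere k)
      (.of_forall fun v => hloss (Function.update u s v))
  linarith [norm_sub_le (S.lossVec u s) (S.mean u s), hloss u, show ‖S.noise u s‖ =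
    ‖S.lossVec u s - S.mean u s‖ from rfl]

lemma integral_inner_lossVec {Y : (Fin T → UnitSphere k) → Vec k} (hY : Continuous Y) {s : Fin T}
    (hYs : ∀ u v, Y (Function.update u s v) = Y u) :
    ∫ u, inner ℝ (S.lossVec u s) (Y u) ∂dirLaw k T =
      ∫ u, inner ℝ (S.mean u s) (Y u) ∂dirLaw k T := by
  have hloss := S.continuous_lossVec s
  rw [integral_pi_eq_integral_integral_update _ s
    (integrable_of_continuous_of_compactSpace (by fun_prop))]
  congr 1 with u
  simp only [hYs]
  rw [← integral_lossVec_update, real_inner_comm, ← integral_inner]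
  · simp only [real_inner_comm]
  · exact integrable_of_continuous_of_compactSpace
      (hloss.comp (continuous_const.update s continuous_id))

lemma integral_inner_noise {Y : (Fin T → UnitSphere k) → Vec k} (hY : Continuous Y) {s : Fin T}
    (hYs : ∀ u v, Y (Function.update u s v) = Y u) :
    ∫ u, inner ℝ (S.noise u s) (Y u) ∂dirLaw k T = 0 := by
  have hloss := S.continuous_lossVec s
  have hmean := S.continuous_mean s
  simp only [noise, inner_sub_left]
  rw [integral_sub (integrable_of_continuous_of_compactSpace (by fun_prop))
    (integrable_of_continuous_of_compactSpace (by fun_prop)), S.integral_inner_lossVec hY hYs,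
    sub_self]

lemma integral_inner_noise_noise {i j : Fin T} (hij : i ≠ j) :
    ∫ u, inner ℝ (S.noise u i) (S.noise u j) ∂dirLaw k T = 0 := by
  rcases lt_or_gt_of_ne hij with hlt | hgt
  · simp only [real_inner_comm (S.noise _ j)]
    exact S.integral_inner_noise (S.continuous_noise i) fun u v => S.noise_update_of_lt u hlt v
  · exact S.integral_inner_noise (S.continuous_noise j) fun u v => S.noise_update_of_lt u hgt v

lemma integral_norm_sum_noise_sq_le {V : ℝ} (hV : ∀ s : Fin T, k * S.M / S.δ (s + 1) ≤ V)
    (A : Finset (Fin T)) :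
    ∫ u, ‖∑ s ∈ A, S.noise u s‖ ^ 2 ∂dirLaw k T ≤ A.card * (2 * V) ^ 2 := by
  have hcont := S.continuous_noise
  rw [integral_norm_sum_sq_of_pairwise_orthogonal
    (fun i _ j _ => integrable_of_continuous_of_compactSpace ((hcont i).inner (hcont j)))
    (fun i _ j _ hij => S.integral_inner_noise_noise hij), ← nsmul_eq_mul]
  refine Finset.sum_le_card_nsmul _ _ _ fun s _ => ?_
  have hmono := integral_mono (μ := dirLaw k T)
    (integrable_of_continuous_of_compactSpace ((hcont s).norm.pow 2)) (integrable_const _)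
    fun u => pow_le_pow_left₀ (norm_nonneg _) (S.norm_noise_le u (hV s)) 2
  simpa using hmono

lemma G_pos (s : Fin T) : 0 < S.G :=
  (S.isStrongSubgradient s).pos S.lam_pos S.r_pos S.ball_subset

lemma norm_sum_mean_le (A : Finset (Fin T)) : ‖∑ s ∈ A, S.mean u s‖ ≤ A.card * S.G := by
  simpa using norm_sum_le_of_le A fun s _ => S.norm_mean_le u s

-- The means contribute at most `G` each, while the noise adds up like a martingale.
lemma integral_norm_sum_lossVec_le (hG : 0 < S.G) {V : ℝ}
    (hV : ∀ s : Fin T, k * S.M / S.δ (s + 1) ≤ V) {A : Finset (Fin T)} {d : ℝ} (hd : 0 < d)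
    (hA : A.card ≤ d) :
    ∫ u, ‖∑ s ∈ A, S.lossVec u s‖ ∂dirLaw k T ≤ 3 / 2 * (d * S.G) + 2 * (V ^ 2 / S.G) := by
  have hnoise := S.continuous_noise
  have hloss := S.continuous_lossVec
  have hpointwise (u) : ‖∑ s ∈ A, S.lossVec u s‖ ≤
      3 / 2 * (d * S.G) + (2 * (d * S.G))⁻¹ * ‖∑ s ∈ A, S.noise u s‖ ^ 2 := by
    have hsplit : ∑ s ∈ A, S.lossVec u s = ∑ s ∈ A, S.mean u s + ∑ s ∈ A, S.noise u s := by
      simp [noise]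
    have hmean : ‖∑ s ∈ A, S.mean u s‖ ≤ d * S.G := (S.norm_sum_mean_le u A).trans (by gcongr)
    rw [hsplit]
    linarith [norm_add_le (∑ s ∈ A, S.mean u s) (∑ s ∈ A, S.noise u s),
      le_half_add_inv_mul_sq (mul_pos hd hG) ‖∑ s ∈ A, S.noise u s‖]
  have hint : Integrable (fun u => (2 * (d * S.G))⁻¹ * ‖∑ s ∈ A, S.noise u s‖ ^ 2) (dirLaw k T) :=
    integrable_of_continuous_of_compactSpace (by fun_prop)
  calc ∫ u, ‖∑ s ∈ A, S.lossVec u s‖ ∂dirLaw k T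
      ≤ ∫ u, (3 / 2 * (d * S.G) + (2 * (d * S.G))⁻¹ * ‖∑ s ∈ A, S.noise u s‖ ^ 2) ∂dirLaw k T :=
        integral_mono (integrable_of_continuous_of_compactSpace (by fun_prop))
          ((integrable_const _).add hint) hpointwise
    _ = 3 / 2 * (d * S.G) + (2 * (d * S.G))⁻¹ * ∫ u, ‖∑ s ∈ A, S.noise u s‖ ^ 2 ∂dirLaw k T := by
        rw [integral_add (integrable_const _) hint, integral_const, probReal_univ, one_smul,
          integral_const_mul]
    _ ≤ 3 / 2 * (d * S.G) + (2 * (d * S.G))⁻¹ * (d * (2 * V) ^ 2) := by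
        gcongr
        exact (S.integral_norm_sum_noise_sq_le hV A).trans (by gcongr)
    _ = 3 / 2 * (d * S.G) + 2 * (V ^ 2 / S.G) := by field_simp

end Setting

/-! ### Drift of the iterates -/

namespace Setting

variable {k T : ℕ} (S : Setting k T) (u : Fin T → UnitSphere k)

lemma sum_lossSeq_Ico {n m : ℕ} (hm : m ≤ T) :
    ∑ j ∈ Finset.Ico n m, S.lossSeq u j =
      ∑ s with S.τ.rank s ∈ Finset.Ico n m, S.lossVec u s := by
  have hsub : Finset.Ico n m = (Finset.range T).filter (· ∈ Finset.Ico n m) := by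
    ext j
    simp only [Finset.mem_Ico, Finset.mem_filter, Finset.mem_range]
    omega
  conv_lhs => rw [hsub]
  rw [Finset.sum_filter, ← S.τ.sum_comp_rank, Finset.sum_filter]
  simp only [lossSeq_rank]

lemma card_filter_rank_mem_Ico_le (n m : ℕ) :
    (Finset.univ.filter fun s => S.τ.rank s ∈ Finset.Ico n m).card ≤ m - n := by
  rw [← Nat.card_Ico]
  exact Finset.card_le_card_of_injOn S.τ.rank (fun s hs => (Finset.mem_filter.1 hs).2)
    (S.τ.rank_injective.injOn)

variable [NeZero k]

lemma integrable_norm_iter_sub (m n : ℕ) :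
    Integrable (fun u => ‖S.iter u m - S.iter u n‖) (dirLaw k T) :=
  integrable_of_continuous_of_compactSpace ((S.continuous_iter m).sub (S.continuous_iter n)).norm

lemma mul_integral_norm_iter_sub_le {n m : ℕ} (hnm : n ≤ m) :
    m * S.lam * ∫ u, ‖S.iter u m - S.iter u n‖ ∂dirLaw k T ≤
      ∫ u, ‖∑ i ∈ Finset.Ico n m, S.lossSeq u i‖ ∂dirLaw k T +
        S.lam * ∑ j ∈ Finset.Ico n m, ∫ u, ‖S.iter u j - S.iter u n‖ ∂dirLaw k T := by
  have hint (j) := S.integrable_norm_iter_sub j n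
  have hloss : Integrable (fun u => ‖∑ i ∈ Finset.Ico n m, S.lossSeq u i‖) (dirLaw k T) :=
    integrable_of_continuous_of_compactSpace
      (continuous_finsetSum _ fun j _ => S.continuous_lossSeq j).norm
  rw [← integral_const_mul, ← integral_finsetSum _ fun j _ => hint j, ← integral_const_mul,
    ← integral_add hloss ((integrable_finsetSum _ fun j _ => hint j).const_mul _)]
  exact integral_mono ((hint m).const_mul _)
    (hloss.add ((integrable_finsetSum _ fun j _ => hint j).const_mul _))
    fun u => mul_norm_ftrlIter_sub_le S.isCompact S.convex S.lam_pos.le S.z₁_mem hnm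

lemma integral_norm_iter_sub_le_of_lt {V : ℝ} (hV : ∀ s : Fin T, k * S.M / S.δ (s + 1) ≤ V)
    {n m : ℕ} (hnm : n < m) (hm : m ≤ T) :
    ∫ u, ‖S.iter u m - S.iter u n‖ ∂dirLaw k T ≤
      (3 / 2 * ((m - n) * S.G) + 2 * (V ^ 2 / S.G)) / (S.lam * (n + 1)) := by
  have hG := S.G_pos ⟨n, hnm.trans_le hm⟩
  refine le_div_of_mul_le_add_sum_Ico (a := fun j => ∫ u, ‖S.iter u j - S.iter u n‖ ∂dirLaw k T)
    S.lam_pos (by simp) hnm fun j hnj hjm =>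
    (S.mul_integral_norm_iter_sub_le hnj.le).trans (add_le_add_left ?_ _)
  simp only [S.sum_lossSeq_Ico _ (hjm.trans hm)]
  have : (n : ℝ) < m := by exact_mod_cast hnm
  refine S.integral_norm_sum_lossVec_le hG hV (sub_pos.2 this) ?_
  rw [← Nat.cast_sub hnm.le]
  exact_mod_cast (S.card_filter_rank_mem_Ico_le n j).trans (Nat.sub_le_sub_right hjm n)

lemma integral_norm_iter_sub_le (s : Fin T) (m n : ℕ) :
    ∫ u, ‖S.iter u m - S.iter u n‖ ∂dirLaw k T ≤ 2 * S.G / S.lam := by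
  simpa using integral_mono (S.integrable_norm_iter_sub m n) (integrable_const _)
    fun u => (S.isStrongSubgradient s).norm_sub_le S.lam_pos (S.iter_mem u m) (S.iter_mem u n)

lemma mul_integral_norm_iter_sub_le_of_le_two_mul {V : ℝ}
    (hV : ∀ s : Fin T, k * S.M / S.δ (s + 1) ≤ V) {n m : ℕ} (hnm : n < m) (hm : m ≤ T)
    (hshort : (m : ℝ) + 1 ≤ 2 * (n + 1)) :
    S.G * ∫ u, ‖S.iter u m - S.iter u n‖ ∂dirLaw k T ≤
      4 * (S.G ^ 2 / S.lam * ((m - n) / (m + 1)) + V ^ 2 / S.lam * (1 / (m + 1))) := by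
  have hlam := S.lam_pos
  have hG := S.G_pos ⟨n, hnm.trans_le hm⟩
  have hsub : (0 : ℝ) ≤ m - n := sub_nonneg.2 (by exact_mod_cast hnm.le)
  have hinv : 1 / ((n : ℝ) + 1) ≤ 2 / (m + 1) := by
    rw [div_le_div_iff₀ (by positivity) (by positivity)]
    linarith
  have hterm : 0 ≤ S.G ^ 2 / S.lam * ((m - n) / (m + 1)) := by positivity
  calc S.G * ∫ u, ‖S.iter u m - S.iter u n‖ ∂dirLaw k T
      ≤ S.G * ((3 / 2 * ((m - n) * S.G) + 2 * (V ^ 2 / S.G)) / (S.lam * (n + 1))) := by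
        gcongr
        exact S.integral_norm_iter_sub_le_of_lt hV hnm hm
    _ = (3 / 2 * ((m - n) * S.G ^ 2) + 2 * V ^ 2) / S.lam * (1 / (n + 1)) := by field_simp
    _ ≤ (3 / 2 * ((m - n) * S.G ^ 2) + 2 * V ^ 2) / S.lam * (2 / (m + 1)) := by gcongr
    _ = 3 * (S.G ^ 2 / S.lam * ((m - n) / (m + 1))) + 4 * (V ^ 2 / S.lam * (1 / (m + 1))) := by
        ring
    _ ≤ _ := by linarith

lemma mul_integral_norm_iter_sub_le_of_two_mul_lt (s : Fin T) {n m : ℕ}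
    (hlong : 2 * ((n : ℝ) + 1) < m + 1) :
    S.G * ∫ u, ‖S.iter u m - S.iter u n‖ ∂dirLaw k T ≤
      4 * (S.G ^ 2 / S.lam * ((m - n) / (m + 1))) := by
  have hlam := S.lam_pos
  have hG := S.G_pos s
  have hhalf : (1 : ℝ) ≤ 2 * ((m - n) / (m + 1)) := by
    rw [← mul_div_assoc, le_div_iff₀ (by positivity)]
    linarith
  calc S.G * ∫ u, ‖S.iter u m - S.iter u n‖ ∂dirLaw k T
      ≤ S.G * (2 * S.G / S.lam) := by gcongr; exact S.integral_norm_iter_sub_le s m n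
    _ = 2 * (S.G ^ 2 / S.lam) * 1 := by ring
    _ ≤ 2 * (S.G ^ 2 / S.lam) * (2 * ((m - n) / (m + 1))) := by gcongr
    _ = 4 * (S.G ^ 2 / S.lam * ((m - n) / (m + 1))) := by ring

-- If `m + 1 ≤ 2 (n + 1)`, the denominator `n + 1` of the drift bound is comparable with `m + 1`;
-- otherwise `m - n` is comparable with `m + 1`, and the diameter of `K` is a sufficient bound.
lemma mul_integral_norm_iter_rank_sub_iter_seen_le {V : ℝ}
    (hV : ∀ s : Fin T, k * S.M / S.δ (s + 1) ≤ V) (s : Fin T) :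
    S.G * ∫ u, ‖S.iter u (S.τ.rank s) - S.iter u (S.τ.seen s)‖ ∂dirLaw k T ≤
      4 * (S.G ^ 2 / S.lam * (S.τ.dualDelay s / (S.τ.rank s + 1)) +
        V ^ 2 / S.lam * (1 / (S.τ.rank s + 1))) := by
  have hd : (S.τ.dualDelay s : ℝ) = S.τ.rank s - S.τ.seen s :=
    eq_sub_of_add_eq' (by exact_mod_cast S.τ.seen_add_dualDelay s)
  have hlam := S.lam_pos
  have hV_term : 0 ≤ V ^ 2 / S.lam * (1 / ((S.τ.rank s : ℝ) + 1)) := by positivity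
  rw [hd]
  rcases (S.τ.seen_le_rank s).eq_or_lt with heq | hlt
  · simpa [heq] using hV_term
  rcases le_or_gt ((S.τ.rank s : ℝ) + 1) (2 * (S.τ.seen s + 1)) with hshort | hlong
  · exact S.mul_integral_norm_iter_sub_le_of_le_two_mul hV hlt (S.τ.rank_lt s).le hshort
  · linarith [S.mul_integral_norm_iter_sub_le_of_two_mul_lt s hlong]

end Setting

/-! ### Regret for arbitrary smoothing parameters -/

namespace Setting

variable {k T : ℕ} (S : Setting k T) (v : Vec k) (u : Fin T → UnitSphere k)

/-- The regret of the wrapper against `v` as a function of the exploration directions. -/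
noncomputable def regret : ℝ :=
  DelayedBCO.regret (pFTRL S.K (strongRate S.lam) S.z₁) S.r S.δ S.τ S.f u v

/-- The regret of P-FTRL against `v` in the quadratic loss built from the loss vector of round `s`,
evaluated at the iterate that receives this loss vector. -/
noncomputable def surrogateRegret (s : Fin T) : ℝ :=
  inner ℝ (S.lossVec u s) (S.iter u (S.τ.rank s) - v) -
    S.lam / 2 * ‖S.iter u (S.τ.rank s) - v‖ ^ 2

lemma regret_eq_sum : S.regret v u = ∑ t, (S.f t (S.pred u t) - S.f t v) :=
  rfl

lemma continuous_loss_pred_sub (t : Fin T) : Continuous fun u => S.f t (S.pred u t) - S.f t v :=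
  (S.continuous_loss_pred t).sub continuous_const

lemma continuous_regret : Continuous fun u => S.regret v u := by
  have := S.continuous_loss_pred_sub v
  simp only [regret_eq_sum]
  fun_prop

lemma continuous_surrogateRegret (s : Fin T) : Continuous fun u => S.surrogateRegret v u s := by
  have := S.continuous_lossVec s
  have := S.continuous_iter
  unfold surrogateRegret
  fun_prop

variable {v}

lemma regret_le (hv : v ∈ S.K) : S.regret v u ≤ T * (2 * (S.G ^ 2 / S.lam)) := by
  have hround (t : Fin T) : S.f t (S.pred u t) - S.f t v ≤ 2 * (S.G ^ 2 / S.lam) := by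
    have hG := (S.isStrongSubgradient t).nonneg hv
    calc S.f t (S.pred u t) - S.f t v ≤ S.G * ‖S.pred u t - v‖ :=
          (S.isStrongSubgradient t).sub_le S.lam_pos.le (S.pred_mem u t) hv
      _ ≤ S.G * (2 * S.G / S.lam) := by
          gcongr
          exact (S.isStrongSubgradient t).norm_sub_le S.lam_pos (S.pred_mem u t) hv
      _ = 2 * (S.G ^ 2 / S.lam) := by ring
  simpa [regret_eq_sum] using Finset.sum_le_card_nsmul Finset.univ _ _ fun t _ => hround t

lemma sum_surrogateRegret_le {V : ℝ} (hV : ∀ s : Fin T, k * S.M / S.δ (s + 1) ≤ V)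
    (hv : v ∈ S.K) :
    ∑ s, S.surrogateRegret v u s ≤ V ^ 2 / S.lam * ∑ j ∈ Finset.range T, 1 / ((j : ℝ) + 1) := by
  have hlam := S.lam_pos
  have hloss {j : ℕ} (hj : j < T) : ‖S.lossSeq u j‖ ≤ V := by
    rw [S.lossSeq_of_lt u hj]
    exact (S.norm_lossVec_le u _).trans (hV _)
  calc ∑ s, S.surrogateRegret v u s
      = ∑ j ∈ Finset.range T, (inner ℝ (S.lossSeq u j) (S.iter u j - v) -
          S.lam / 2 * ‖S.iter u j - v‖ ^ 2) := by
        simp only [surrogateRegret, ← lossSeq_rank, ← S.τ.sum_comp_rank]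
    _ ≤ ∑ j ∈ Finset.range T, ‖S.lossSeq u j‖ ^ 2 / (2 * (j + 1) * S.lam) :=
        ftrl_regret_le S.isCompact S.convex S.lam_pos S.z₁_mem T hv
    _ ≤ ∑ j ∈ Finset.range T, V ^ 2 / (1 * (j + 1) * S.lam) := by
        refine Finset.sum_le_sum fun j hj => ?_
        gcongr
        · exact hloss (Finset.mem_range.1 hj)
        · norm_num
    _ = V ^ 2 / S.lam * ∑ j ∈ Finset.range T, 1 / ((j : ℝ) + 1) := by
        rw [Finset.mul_sum]
        exact Finset.sum_congr rfl fun j _ => by field_simp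

variable [NeZero k]

lemma integrable_surrogateRegret (s : Fin T) :
    Integrable (fun u => S.surrogateRegret v u s) (dirLaw k T) :=
  integrable_of_continuous_of_compactSpace (S.continuous_surrogateRegret v s)

lemma integral_surrogateRegret (s : Fin T) :
    ∫ u, S.surrogateRegret v u s ∂dirLaw k T =
      ∫ u, (inner ℝ (S.mean u s) (S.iter u (S.τ.rank s) - v) -
        S.lam / 2 * ‖S.iter u (S.τ.rank s) - v‖ ^ 2) ∂dirLaw k T := by
  have hloss := S.continuous_lossVec s
  have hmean := S.continuous_mean s
  have hiter := S.continuous_iter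
  have hcomp : Continuous fun u => S.iter u (S.τ.rank s) - v := by fun_prop
  have hsq : Integrable (fun u => S.lam / 2 * ‖S.iter u (S.τ.rank s) - v‖ ^ 2) (dirLaw k T) :=
    integrable_of_continuous_of_compactSpace (by fun_prop)
  simp only [surrogateRegret]
  rw [integral_sub (integrable_of_continuous_of_compactSpace (hloss.inner hcomp)) hsq,
    integral_sub (integrable_of_continuous_of_compactSpace (hmean.inner hcomp)) hsq,
    S.integral_inner_lossVec hcomp fun u w => by rw [S.iter_update u le_rfl w]]

-- The one-point bound holds at the iterate `Y` used for the prediction; passing to the iterate `Z`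
-- that receives the feedback costs a multiple of the drift `‖Z - Y‖`.
lemma loss_pred_sub_le (hv : v ∈ S.K) (s : Fin T) :
    S.f s (S.pred u s) - S.f s v ≤
      inner ℝ (S.mean u s) (S.iter u (S.τ.rank s) - v) -
        S.lam / 2 * ‖S.iter u (S.τ.rank s) - v‖ ^ 2 +
      3 * (S.G * ‖S.iter u (S.τ.rank s) - S.iter u (S.τ.seen s)‖) +
      16 * (S.δ (s + 1) / S.r) * (S.G ^ 2 / S.lam) := by
  have hone : S.f s (S.pred u s) - S.f s v ≤
      inner ℝ (S.mean u s) (S.iter u (S.τ.seen s) - v) -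
        S.lam / 2 * ‖S.iter u (S.τ.seen s) - v‖ ^ 2 +
      16 * (S.δ (s + 1) / S.r) * (S.G ^ 2 / S.lam) :=
    (S.isStrongSubgradient s).sub_le_inner_onePointGradient S.lam_pos (S.δ_pos s) S.r_pos
      S.ball_subset (S.iter_mem u _) hv (S.closedBall_center_subset u s) (S.pred_mem_closedBall u s)
  have hsq := (S.isStrongSubgradient s).half_mul_norm_sub_sq_sub_le S.lam_pos
    (S.iter_mem u (S.τ.rank s)) (S.iter_mem u (S.τ.seen s)) hv
  set Y := S.iter u (S.τ.seen s)
  set Z := S.iter u (S.τ.rank s)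
  have hinner : inner ℝ (S.mean u s) (Y - v) ≤ inner ℝ (S.mean u s) (Z - v) + S.G * ‖Z - Y‖ := by
    rw [← sub_le_iff_le_add', ← inner_sub_right, sub_sub_sub_cancel_right, norm_sub_rev]
    exact (real_inner_le_norm _ _).trans (by gcongr; exact S.norm_mean_le u s)
  linarith

lemma integral_loss_pred_sub_le {V : ℝ} (hV : ∀ s : Fin T, k * S.M / S.δ (s + 1) ≤ V)
    (hv : v ∈ S.K) (s : Fin T) :
    ∫ u, (S.f s (S.pred u s) - S.f s v) ∂dirLaw k T ≤
      ∫ u, S.surrogateRegret v u s ∂dirLaw k T +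
      12 * (S.G ^ 2 / S.lam * (S.τ.dualDelay s / (S.τ.rank s + 1)) +
        V ^ 2 / S.lam * (1 / (S.τ.rank s + 1))) +
      16 * (S.δ (s + 1) / S.r) * (S.G ^ 2 / S.lam) := by
  have hmean := S.continuous_mean s
  have hiter := S.continuous_iter
  have hmain : Integrable (fun u => inner ℝ (S.mean u s) (S.iter u (S.τ.rank s) - v) -
      S.lam / 2 * ‖S.iter u (S.τ.rank s) - v‖ ^ 2) (dirLaw k T) :=
    integrable_of_continuous_of_compactSpace (by fun_prop)
  have hdrift := ((S.integrable_norm_iter_sub (S.τ.rank s) (S.τ.seen s)).const_mul S.G).const_mul 3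
  have hbound := integral_mono
    (integrable_of_continuous_of_compactSpace (S.continuous_loss_pred_sub v s))
    ((hmain.add hdrift).add (integrable_const (16 * (S.δ (s + 1) / S.r) * (S.G ^ 2 / S.lam))))
    fun u => S.loss_pred_sub_le u hv s
  rw [integral_add' (hmain.add hdrift) (integrable_const _), integral_add' hmain hdrift,
    ← S.integral_surrogateRegret, integral_const_mul, integral_const_mul, integral_const,
    probReal_univ, one_smul] at hbound
  linarith [S.mul_integral_norm_iter_rank_sub_iter_seen_le hV s]

lemma sum_integral_surrogateRegret_le {V : ℝ} (hV : ∀ s : Fin T, k * S.M / S.δ (s + 1) ≤ V)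
    (hv : v ∈ S.K) :
    ∑ s, ∫ u, S.surrogateRegret v u s ∂dirLaw k T ≤
      V ^ 2 / S.lam * ∑ j ∈ Finset.range T, 1 / ((j : ℝ) + 1) := by
  rw [← integral_finsetSum _ fun s _ => S.integrable_surrogateRegret s]
  simpa using integral_mono (integrable_finsetSum _ fun s _ => S.integrable_surrogateRegret s)
    (integrable_const _) fun u => S.sum_surrogateRegret_le u hV hv

lemma integral_regret_le (hT : 2 ≤ T) {V : ℝ} (hV : ∀ s : Fin T, k * S.M / S.δ (s + 1) ≤ V)
    (hv : v ∈ S.K) :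
    ∫ u, S.regret v u ∂dirLaw k T ≤
      39 * (V ^ 2 / S.lam * Real.log T) +
      36 * (S.G ^ 2 / S.lam * min (S.τ.maxBacklog * Real.log T) (√(S.τ.totalDelay : ℝ))) +
      16 * (S.G ^ 2 / S.lam * ∑ s : Fin T, S.δ (s + 1) / S.r) := by
  have hlam := S.lam_pos
  have hsurrogate := S.sum_integral_surrogateRegret_le hV hv
  have hdelay := mul_le_mul_of_nonneg_left (S.τ.sum_dualDelay_div_le hT)
    (show 0 ≤ S.G ^ 2 / S.lam by positivity)
  have hlog := mul_le_mul_of_nonneg_left (sum_range_one_div_le_log hT)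
    (show 0 ≤ V ^ 2 / S.lam by positivity)
  calc ∫ u, S.regret v u ∂dirLaw k T
      = ∑ s, ∫ u, (S.f s (S.pred u s) - S.f s v) ∂dirLaw k T := by
        simp only [regret_eq_sum]
        exact integral_finsetSum _ fun s _ =>
          integrable_of_continuous_of_compactSpace (S.continuous_loss_pred_sub v s)
    _ ≤ ∑ s, (∫ u, S.surrogateRegret v u s ∂dirLaw k T +
          12 * (S.G ^ 2 / S.lam * (S.τ.dualDelay s / (S.τ.rank s + 1)) +
            V ^ 2 / S.lam * (1 / (S.τ.rank s + 1))) +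
          16 * (S.δ (s + 1) / S.r) * (S.G ^ 2 / S.lam)) :=
        Finset.sum_le_sum fun s _ => S.integral_loss_pred_sub_le hV hv s
    _ = ∑ s, ∫ u, S.surrogateRegret v u s ∂dirLaw k T +
          12 * (S.G ^ 2 / S.lam * ∑ s, (S.τ.dualDelay s : ℝ) / (S.τ.rank s + 1) +
            V ^ 2 / S.lam * ∑ j ∈ Finset.range T, 1 / ((j : ℝ) + 1)) +
          16 * (S.G ^ 2 / S.lam * ∑ s : Fin T, S.δ (s + 1) / S.r) := by
        simp only [← S.τ.sum_comp_rank, Finset.sum_add_distrib, Finset.mul_sum, mul_add]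
        congr 1
        exact Finset.sum_congr rfl fun s _ => by ring
    _ ≤ _ := by linarith

end Setting

/-! ### Smoothing schedules -/

section CubeRoots

lemma rpow_one_third_pow_three {x : ℝ} (hx : 0 ≤ x) : (x ^ (1 / 3 : ℝ)) ^ 3 = x := by
  rw [← Real.rpow_mul_natCast hx]
  norm_num

lemma rpow_two_thirds_eq_sq {x : ℝ} (hx : 0 ≤ x) : x ^ (2 / 3 : ℝ) = (x ^ (1 / 3 : ℝ)) ^ 2 := by
  rw [← Real.rpow_mul_natCast hx]
  norm_num

lemma rpow_one_third_le_two_mul {x y : ℝ} (hx : 0 ≤ x) (hxy : x ≤ 8 * y) :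
    x ^ (1 / 3 : ℝ) ≤ 2 * y ^ (1 / 3 : ℝ) := by
  have hy : 0 ≤ y := by linarith
  have hpow : x ≤ (2 * y ^ (1 / 3 : ℝ)) ^ 3 := by
    rw [mul_pow, rpow_one_third_pow_three hy]
    linarith
  refine le_of_pow_le_pow_left₀ three_ne_zero (by positivity) ?_
  rwa [rpow_one_third_pow_three hx]

lemma one_div_add_one_rpow_one_third_le {t : ℝ} (ht : 0 ≤ t) :
    1 / (t + 1) ^ (1 / 3 : ℝ) ≤ 3 / 2 * ((t + 1) ^ (2 / 3 : ℝ) - t ^ (2 / 3 : ℝ)) := by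
  have ha : 0 < (t + 1) ^ (1 / 3 : ℝ) := by positivity
  have hb : 0 ≤ t ^ (1 / 3 : ℝ) := by positivity
  have ha₃ := rpow_one_third_pow_three (show 0 ≤ t + 1 by positivity)
  have hb₃ := rpow_one_third_pow_three ht
  rw [rpow_two_thirds_eq_sq ht, rpow_two_thirds_eq_sq (by positivity), div_le_iff₀ ha]
  set a := (t + 1) ^ (1 / 3 : ℝ)
  set b := t ^ (1 / 3 : ℝ)
  calc (1 : ℝ) = a ^ 3 - b ^ 3 := by rw [ha₃, hb₃]; ring
    _ ≤ a ^ 3 - b ^ 3 + 1 / 2 * ((a - b) ^ 2 * (a + 2 * b)) :=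
        le_add_of_nonneg_right (by positivity)
    _ = 3 / 2 * (a ^ 2 - b ^ 2) * a := by ring

lemma sum_range_one_div_rpow_one_third_le (n : ℕ) :
    ∑ t ∈ Finset.range n, 1 / ((t : ℝ) + 1) ^ (1 / 3 : ℝ) ≤ 3 / 2 * (n : ℝ) ^ (2 / 3 : ℝ) := by
  calc ∑ t ∈ Finset.range n, 1 / ((t : ℝ) + 1) ^ (1 / 3 : ℝ)
      ≤ ∑ t ∈ Finset.range n, 3 / 2 * (((t + 1 : ℕ) : ℝ) ^ (2 / 3 : ℝ) - (t : ℝ) ^ (2 / 3 : ℝ)) :=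
        Finset.sum_le_sum fun t _ => by
          exact_mod_cast one_div_add_one_rpow_one_third_le t.cast_nonneg
    _ = 3 / 2 * (n : ℝ) ^ (2 / 3 : ℝ) := by
        rw [← Finset.mul_sum, Finset.sum_range_sub (fun t : ℕ => (t : ℝ) ^ (2 / 3 : ℝ))]
        simp

lemma rpow_mul_rpow_mul_rpow_eq {x y z : ℝ} (hx : 0 ≤ x) (hy : 0 ≤ y) :
    z ^ (2 / 3 : ℝ) * y ^ (1 / 3 : ℝ) * x ^ (2 / 3 : ℝ) =
      (x ^ 2 * y) ^ (1 / 3 : ℝ) * z ^ (2 / 3 : ℝ) := by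
  have hx_sq : (x ^ 2) ^ (1 / 3 : ℝ) = x ^ (2 / 3 : ℝ) := by
    rw [← Real.rpow_natCast_mul hx]
    norm_num
  rw [Real.mul_rpow (sq_nonneg x) hy, hx_sq]
  ring

end CubeRoots

section Schedules

lemma log_div_self_le_one {n : ℕ} (hn : 0 < n) : Real.log n / n ≤ 1 := by
  have hn' : (0 : ℝ) < n := by exact_mod_cast hn
  rw [div_le_one hn']
  linarith [Real.log_le_sub_one_of_pos hn']

-- `log t / t` decreases from `t = 3` on, so the factor `8` is only needed for `t = 2`.
lemma log_div_self_le_mul {t n : ℕ} (ht : 2 ≤ t) (htn : t ≤ n) :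
    Real.log n / n ≤ 8 * (Real.log t / t) := by
  rcases ht.eq_or_lt with rfl | h3
  · have := log_div_self_le_one (show 0 < n by omega)
    push_cast
    linarith [Real.log_two_gt_d9]
  · have hle : (t : ℝ) ≤ n := by exact_mod_cast htn
    have he : Real.exp 1 ≤ t := by
      have : (3 : ℝ) ≤ t := by exact_mod_cast h3
      linarith [Real.exp_one_lt_d9]
    have hanti : Real.log n / n ≤ Real.log t / t :=
      Real.log_div_self_antitoneOn he (he.trans hle) hle
    have : 0 ≤ Real.log t / t := by
      have := Real.log_natCast_nonneg t
      positivity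
    linarith

variable {k T : ℕ} {r ν : ℝ} {δ : ℕ → ℝ}

lemma smoothing_le (hr : 0 ≤ r) (t : ℕ) : smoothing k r ν t ≤ r :=
  mul_le_of_le_one_right hr (min_le_left _ _)

lemma smoothing_pos [NeZero k] (hr : 0 < r) (hν : 0 < ν) {t : ℕ} (ht : 2 ≤ t) :
    0 < smoothing k r ν t := by
  have hk : (0 : ℝ) < k := by exact_mod_cast Nat.pos_of_neZero k
  have ht' : (1 : ℝ) < t := by exact_mod_cast ht
  have := Real.log_pos ht'
  exact mul_pos hr (lt_min one_pos (by positivity))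

lemma rpow_log_div_le_two_mul {n : ℕ} {x : ℝ} (h : Real.log n / n ≤ 8 * x) :
    (ν ^ 2 * (k : ℝ) ^ 2 * Real.log n / n) ^ (1 / 3 : ℝ) ≤
      2 * (ν ^ 2 * (k : ℝ) ^ 2 * x) ^ (1 / 3 : ℝ) := by
  have := Real.log_natCast_nonneg n
  refine rpow_one_third_le_two_mul (by positivity) ?_
  rw [mul_div_assoc, mul_left_comm]
  gcongr

lemma smoothing_div_le_two_mul (hr : 0 < r) {n : ℕ} {x : ℝ} (h : Real.log n / n ≤ 8 * x) :
    smoothing k r ν n / r ≤ 2 * (ν ^ 2 * (k : ℝ) ^ 2 * x) ^ (1 / 3 : ℝ) := by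
  rw [smoothing, mul_div_cancel_left₀ _ hr.ne']
  exact (min_le_right _ _).trans (rpow_log_div_le_two_mul h)

lemma smoothing_le_two_mul_smoothing (hr : 0 ≤ r) {t n : ℕ} (ht : 2 ≤ t) (htn : t ≤ n) :
    smoothing k r ν n ≤ 2 * smoothing k r ν t := by
  have hroot := rpow_log_div_le_two_mul (k := k) (ν := ν) (log_div_self_le_mul ht htn)
  rw [← mul_div_assoc] at hroot
  rw [smoothing, smoothing, mul_left_comm, mul_min_of_nonneg (a := (2 : ℝ)) _ _ zero_le_two]
  exact mul_le_mul_of_nonneg_left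
    (le_min ((min_le_left _ _).trans (by norm_num)) ((min_le_right _ _).trans hroot)) hr

/-- The smoothing parameters follow one of the two schedules of the theorem. -/
def IsSchedule (k T : ℕ) (r ν : ℝ) (δ : ℕ → ℝ) : Prop :=
  IsRoundDependentSchedule k r ν δ ∨ IsFixedSchedule k T r ν δ

namespace IsSchedule

lemma smoothing_le_two_mul (h : IsSchedule k T r ν δ) (hr : 0 ≤ r) (hT : 2 ≤ T) {t : ℕ}
    (ht : 1 ≤ t) (htT : t ≤ T) : smoothing k r ν T ≤ 2 * δ t := by
  rcases h with h | h
  · rcases Nat.lt_or_ge t 3 with h3 | h3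
    · linarith [(h.2 t ht (by omega)).1,
        smoothing_le_two_mul_smoothing (k := k) (ν := ν) hr le_rfl hT]
    · rw [h.1 t h3]
      exact smoothing_le_two_mul_smoothing hr (by omega) htT
  · rw [h t ht]
    exact smoothing_le_two_mul_smoothing hr hT le_rfl

lemma pos [NeZero k] (h : IsSchedule k T r ν δ) (hr : 0 < r) (hν : 0 < ν) (hT : 2 ≤ T) {t : ℕ}
    (ht : 1 ≤ t) (htT : t ≤ T) : 0 < δ t := by
  linarith [h.smoothing_le_two_mul hr.le hT ht htT, smoothing_pos (k := k) hr hν hT]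

lemma exists_le_smoothing (h : IsSchedule k T r ν δ) (hT : 2 ≤ T) {t : ℕ} (ht : 1 ≤ t)
    (htT : t ≤ T) :
    ∃ n : ℕ, Real.log n / n ≤ 8 * (Real.log T / t) ∧ δ t ≤ smoothing k r ν n := by
  have := Real.log_natCast_nonneg T
  have ht₀ : (0 : ℝ) < t := by exact_mod_cast ht
  have htT' : (t : ℝ) ≤ T := by exact_mod_cast htT
  have hself : Real.log T / t ≤ 8 * (Real.log T / t) := by
    have : 0 ≤ Real.log T / t := by positivity
    linarith
  rcases h with h | h
  · rcases Nat.lt_or_ge t 3 with h3 | h3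
    · refine ⟨3, (log_div_self_le_one (by norm_num)).trans ?_, (h.2 t ht (by omega)).2⟩
      have hlog_two : Real.log 2 ≤ Real.log T :=
        Real.log_le_log (by norm_num) (by exact_mod_cast hT)
      have : (t : ℝ) ≤ 2 := by exact_mod_cast Nat.le_of_lt_succ h3
      rw [← mul_div_assoc, le_div_iff₀ ht₀]
      linarith [Real.log_two_gt_d9]
    · refine ⟨t, le_trans ?_ hself, (h.1 t h3).le⟩
      gcongr
  · refine ⟨T, le_trans ?_ hself, (h t ht).le⟩
    gcongr

lemma le (h : IsSchedule k T r ν δ) (hr : 0 ≤ r) (hT : 2 ≤ T) {t : ℕ} (ht : 1 ≤ t)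
    (htT : t ≤ T) : δ t ≤ r := by
  obtain ⟨n, -, hn⟩ := h.exists_le_smoothing hT ht htT
  exact hn.trans (smoothing_le hr n)

lemma div_le (h : IsSchedule k T r ν δ) (hr : 0 < r) (hT : 2 ≤ T) {t : ℕ} (ht : 1 ≤ t)
    (htT : t ≤ T) :
    δ t / r ≤ 2 * ((ν ^ 2 * (k : ℝ) ^ 2 * Real.log T) ^ (1 / 3 : ℝ) / (t : ℝ) ^ (1 / 3 : ℝ)) := by
  obtain ⟨n, hlog, hn⟩ := h.exists_le_smoothing hT ht htT
  have := Real.log_natCast_nonneg T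
  rw [← Real.div_rpow (by positivity) t.cast_nonneg, mul_div_assoc]
  exact (by gcongr : δ t / r ≤ _).trans (smoothing_div_le_two_mul hr hlog)

lemma sum_div_le (h : IsSchedule k T r ν δ) (hr : 0 < r) (hT : 2 ≤ T) :
    ∑ s : Fin T, δ (s + 1) / r ≤
      3 * ((ν ^ 2 * (k : ℝ) ^ 2 * Real.log T) ^ (1 / 3 : ℝ) * (T : ℝ) ^ (2 / 3 : ℝ)) := by
  have := Real.log_natCast_nonneg T
  set c := (ν ^ 2 * (k : ℝ) ^ 2 * Real.log T) ^ (1 / 3 : ℝ)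
  calc ∑ s : Fin T, δ (s + 1) / r ≤ ∑ s : Fin T, 2 * (c / ((s : ℝ) + 1) ^ (1 / 3 : ℝ)) :=
        Finset.sum_le_sum fun s _ => by
          simpa only [Nat.cast_add_one] using h.div_le hr hT (t := s + 1) (by omega) (by omega)
    _ = 2 * c * ∑ t ∈ Finset.range T, 1 / ((t : ℝ) + 1) ^ (1 / 3 : ℝ) := by
        rw [Finset.mul_sum, Finset.sum_range]
        exact Finset.sum_congr rfl fun s _ => by ring
    _ ≤ 2 * c * (3 / 2 * (T : ℝ) ^ (2 / 3 : ℝ)) := by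
        gcongr
        exact sum_range_one_div_rpow_one_third_le T
    _ = 3 * (c * (T : ℝ) ^ (2 / 3 : ℝ)) := by ring

end IsSchedule

end Schedules

namespace Setting

variable {k T : ℕ} (S : Setting k T)

/-- The ratio `ν = M / (G r)` of the losses. -/
noncomputable def ratio : ℝ :=
  S.M / (S.G * S.r)

/-- The factor `(ν² k² ln T)^{1/3}` of the smoothing parameter, without the factor `T^{-1/3}`. -/
noncomputable def smoothingRate : ℝ :=
  (S.ratio ^ 2 * (k : ℝ) ^ 2 * Real.log T) ^ (1 / 3 : ℝ)

variable {S}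

lemma rpow_mul_rpow_log_mul_rpow_eq (hratio : 0 ≤ S.ratio) :
    (T : ℝ) ^ (2 / 3 : ℝ) * Real.log T ^ (1 / 3 : ℝ) * (S.ratio * k) ^ (2 / 3 : ℝ) =
      S.smoothingRate * (T : ℝ) ^ (2 / 3 : ℝ) := by
  rw [rpow_mul_rpow_mul_rpow_eq (by positivity) (Real.log_natCast_nonneg T), mul_pow,
    smoothingRate]

lemma smoothing_eq_of_smoothingRate_le (hT : 2 ≤ T)
    (hrate : S.smoothingRate ≤ (T : ℝ) ^ (1 / 3 : ℝ)) :
    smoothing k S.r S.ratio T = S.r * (S.smoothingRate / (T : ℝ) ^ (1 / 3 : ℝ)) := by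
  have := Real.log_natCast_nonneg T
  have hT₀ : (0 : ℝ) < T := by exact_mod_cast zero_lt_two.trans_le hT
  rw [smoothing, Real.div_rpow (by positivity) hT₀.le, ← smoothingRate, min_eq_right]
  exact (div_le_one (by positivity)).2 hrate

variable [NeZero k]

lemma smoothingRate_pos (hT : 2 ≤ T) (hratio : 0 < S.ratio) : 0 < S.smoothingRate := by
  have hk : (0 : ℝ) < k := by exact_mod_cast Nat.pos_of_neZero k
  have hlog : 0 < Real.log T := Real.log_pos (by exact_mod_cast hT)
  unfold smoothingRate
  positivity

variable (S)

lemma M_pos (s : Fin T) : 0 < S.M :=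
  (S.isStrongSubgradient s).bound_pos S.lam_pos S.r_pos S.ball_subset (S.abs_le s)

lemma ratio_pos (s : Fin T) : 0 < S.ratio :=
  div_pos (S.M_pos s) (mul_pos (S.G_pos s) S.r_pos)

variable {S}

lemma mul_div_schedule_le (hδ : IsSchedule k T S.r S.ratio S.δ) (hT : 2 ≤ T)
    (hrate : S.smoothingRate ≤ (T : ℝ) ^ (1 / 3 : ℝ)) (s : Fin T) :
    k * S.M / S.δ (s + 1) ≤
      2 * (S.ratio * k) * S.G * (T : ℝ) ^ (1 / 3 : ℝ) / S.smoothingRate := by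
  have hr := S.r_pos
  have hG := S.G_pos s
  have hM := S.M_pos s
  have : (0 : ℝ) < T := by exact_mod_cast zero_lt_two.trans_le hT
  have hrate₀ := smoothingRate_pos hT (S.ratio_pos s)
  have hδ_ge := hδ.smoothing_le_two_mul hr.le hT (t := s + 1) (by omega) (by omega)
  rw [smoothing_eq_of_smoothingRate_le hT hrate, ← div_le_iff₀' two_pos] at hδ_ge
  calc k * S.M / S.δ (s + 1)
      ≤ k * S.M / (S.r * (S.smoothingRate / (T : ℝ) ^ (1 / 3 : ℝ)) / 2) := by gcongr
    _ = 2 * (S.ratio * k) * S.G * (T : ℝ) ^ (1 / 3 : ℝ) / S.smoothingRate := by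
      rw [ratio]
      field_simp

variable {v : Vec k}

lemma integral_regret_le_card_mul (hv : v ∈ S.K) :
    ∫ u, S.regret v u ∂dirLaw k T ≤ T * (2 * (S.G ^ 2 / S.lam)) := by
  simpa using integral_mono (μ := dirLaw k T)
    (integrable_of_continuous_of_compactSpace (S.continuous_regret v)) (integrable_const _)
    fun u => S.regret_le u hv

lemma integral_regret_le_of_le_smoothingRate
    (hrate : (T : ℝ) ^ (1 / 3 : ℝ) ≤ S.smoothingRate) (hv : v ∈ S.K) :
    ∫ u, S.regret v u ∂dirLaw k T ≤
      2 * (S.G ^ 2 / S.lam * (S.smoothingRate * (T : ℝ) ^ (2 / 3 : ℝ))) := by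
  have hlam := S.lam_pos
  have hT : (T : ℝ) = (T : ℝ) ^ (1 / 3 : ℝ) * (T : ℝ) ^ (2 / 3 : ℝ) := by
    rw [rpow_two_thirds_eq_sq T.cast_nonneg, ← pow_succ',
      rpow_one_third_pow_three T.cast_nonneg]
  calc ∫ u, S.regret v u ∂dirLaw k T ≤ T * (2 * (S.G ^ 2 / S.lam)) :=
        integral_regret_le_card_mul hv
    _ = 2 * (S.G ^ 2 / S.lam * ((T : ℝ) ^ (1 / 3 : ℝ) * (T : ℝ) ^ (2 / 3 : ℝ))) := by
        rw [← hT]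
        ring
    _ ≤ 2 * (S.G ^ 2 / S.lam * (S.smoothingRate * (T : ℝ) ^ (2 / 3 : ℝ))) := by gcongr

lemma integral_regret_le_of_smoothingRate_le (hδ : IsSchedule k T S.r S.ratio S.δ) (hT : 2 ≤ T)
    (hrate : S.smoothingRate ≤ (T : ℝ) ^ (1 / 3 : ℝ)) (hv : v ∈ S.K) :
    ∫ u, S.regret v u ∂dirLaw k T ≤
      36 * (S.G ^ 2 / S.lam * min (S.τ.maxBacklog * Real.log T) (√(S.τ.totalDelay : ℝ))) +
      204 * (S.G ^ 2 / S.lam * (S.smoothingRate * (T : ℝ) ^ (2 / 3 : ℝ))) := by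
  have hlam := S.lam_pos
  have hrate₀ := smoothingRate_pos hT (S.ratio_pos ⟨0, by omega⟩)
  have := Real.log_natCast_nonneg T
  have hbound := S.integral_regret_le hT (mul_div_schedule_le hδ hT hrate) hv
  have hδ_sum := mul_le_mul_of_nonneg_left (hδ.sum_div_le S.r_pos hT)
    (show 0 ≤ S.G ^ 2 / S.lam by positivity)
  have hcube : S.smoothingRate ^ 3 = S.ratio ^ 2 * (k : ℝ) ^ 2 * Real.log T :=
    rpow_one_third_pow_three (by positivity)
  have hV : (2 * (S.ratio * k) * S.G * (T : ℝ) ^ (1 / 3 : ℝ) / S.smoothingRate) ^ 2 / S.lam *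
      Real.log T = 4 * (S.G ^ 2 / S.lam * (S.smoothingRate * (T : ℝ) ^ (2 / 3 : ℝ))) := by
    rw [rpow_two_thirds_eq_sq T.cast_nonneg]
    calc _ = 4 * (S.G ^ 2 / S.lam) * ((T : ℝ) ^ (1 / 3 : ℝ)) ^ 2 *
          (S.ratio ^ 2 * (k : ℝ) ^ 2 * Real.log T) / S.smoothingRate ^ 2 := by ring
      _ = _ := by
        rw [← hcube]
        field_simp
  rw [hV] at hbound
  rw [← smoothingRate] at hδ_sum
  linarith

lemma integral_regret_le_of_isSchedule (hδ : IsSchedule k T S.r S.ratio S.δ) (hT : 2 ≤ T)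
    (hv : v ∈ S.K) :
    ∫ u, S.regret v u ∂dirLaw k T ≤ 204 * (S.G ^ 2 / S.lam *
      (min (S.τ.maxBacklog * Real.log T) (√(S.τ.totalDelay : ℝ)) +
        (T : ℝ) ^ (2 / 3 : ℝ) * Real.log T ^ (1 / 3 : ℝ) * (S.ratio * k) ^ (2 / 3 : ℝ))) := by
  have hlam := S.lam_pos
  have hratio := S.ratio_pos ⟨0, by omega⟩
  have hrate₀ := smoothingRate_pos hT hratio
  have := Real.log_natCast_nonneg T
  have hdelay : 0 ≤ S.G ^ 2 / S.lam *
      min (S.τ.maxBacklog * Real.log T) (√(S.τ.totalDelay : ℝ)) := by positivity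
  have hsmooth : 0 ≤ S.G ^ 2 / S.lam * (S.smoothingRate * (T : ℝ) ^ (2 / 3 : ℝ)) := by positivity
  rw [rpow_mul_rpow_log_mul_rpow_eq hratio.le]
  rcases le_total ((T : ℝ) ^ (1 / 3 : ℝ)) S.smoothingRate with hrate | hrate
  · linarith [integral_regret_le_of_le_smoothingRate hrate hv]
  · linarith [integral_regret_le_of_smoothingRate_le hδ hT hrate hv]

end Setting

lemma measurePreserving_dirLaw {k T : ℕ} [NeZero k] {Ω : Type*} [MeasurableSpace Ω]
    {P : Measure Ω} [IsProbabilityMeasure P] {u : Fin T → Ω → UnitSphere k}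
    (hu : ∀ t, Measurable (u t)) (hlaw : ∀ t, P.map (u t) = unifSphere k)
    (hindep : iIndepFun u P) : MeasurePreserving (fun ω t => u t ω) P (dirLaw k T) := by
  refine ⟨measurable_pi_iff.2 hu, ?_⟩
  rw [(iIndepFun_iff_map_fun_eq_pi_map fun t => (hu t).aemeasurable).1 hindep]
  simp only [hlaw]

end DelayedBCO

open DelayedBCO in
theorem mainTheorem2_general {k T : ℕ} (hk : 1 ≤ k) (hT : 2 ≤ T) {K : Set (Vec k)} {r : ℝ}
    (hK : IsClosed K) (hconv : Convex ℝ K) (hr : 0 < r) (hrK : Metric.closedBall 0 r ⊆ K)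
    (τ : LatencyModel T) {f : Fin T → Vec k → ℝ} {g : Fin T → Vec k → Vec k} {G M lam : ℝ}
    (hlam : 0 < lam) (hfg : ∀ t, IsStrongSubgradient K G lam (f t) (g t))
    (hM : ∀ t, ∀ x ∈ K, |f t x| ≤ M) {δ : ℕ → ℝ} (hδ : IsSchedule k T r (M / (G * r)) δ)
    {Ω : Type*} [MeasurableSpace Ω] (P : Measure Ω) [IsProbabilityMeasure P]
    {u : Fin T → Ω → UnitSphere k} (hu : ∀ t, Measurable (u t))
    (hlaw : ∀ t, P.map (u t) = unifSphere k) (hindep : ProbabilityTheory.iIndepFun u P)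
    {z₁ : Vec k} (hz₁ : z₁ ∈ K) {v : Vec k} (hv : v ∈ K) :
    Integrable (fun ω => regret (pFTRL K (strongRate lam) z₁) r δ τ f (fun t => u t ω) v) P ∧
      ∫ ω, regret (pFTRL K (strongRate lam) z₁) r δ τ f (fun t => u t ω) v ∂P ≤
        204 * (G ^ 2 / lam *
          (min (τ.maxBacklog * Real.log T) (√(τ.totalDelay : ℝ)) +
            (T : ℝ) ^ (2 / 3 : ℝ) * Real.log T ^ (1 / 3 : ℝ) *
              (M / (G * r) * k) ^ (2 / 3 : ℝ))) := by
  have : NeZero k := ⟨by omega⟩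
  have hfg₀ := hfg ⟨0, by omega⟩
  have hν : 0 < M / (G * r) := div_pos (hfg₀.bound_pos hlam hr hrK (hM _))
    (mul_pos (hfg₀.pos hlam hr hrK) hr)
  let S : Setting k T :=
    { K, r, G, M, lam, z₁, δ, τ, f, g
      isCompact := Metric.isCompact_of_isClosed_isBounded hK (hfg₀.isBounded hlam)
      convex := hconv
      r_pos := hr
      ball_subset := hrK
      lam_pos := hlam
      isStrongSubgradient := hfg
      abs_le := hM
      z₁_mem := hz₁
      δ_pos := fun t => hδ.pos hr hν hT (by omega) (by omega)
      δ_le := fun t => hδ.le hr.le hT (by omega) (by omega) }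
  have hmp := measurePreserving_dirLaw hu hlaw hindep
  have hint : Integrable (S.regret v) (P.map fun ω t => u t ω) :=
    hmp.map_eq ▸ integrable_of_continuous_of_compactSpace (S.continuous_regret v)
  have hbound := S.integral_regret_le_of_isSchedule hδ hT hv
  rw [← hmp.map_eq, integral_map hmp.aemeasurable hint.aestronglyMeasurable] at hbound
  exact ⟨hint.comp_measurable hmp.measurable, hbound⟩

open DelayedBCO in
theorem mainTheorem2 :
    ∃ C : ℝ, 0 < C ∧
      ∀ (k T : ℕ), 1 ≤ k → 2 ≤ T →
      -- the domain, with `r 𝔹 ⊆ K ⊆ R 𝔹`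
      ∀ (K : Set (Vec k)) (r R : ℝ), IsClosed K → Convex ℝ K → 0 < r → r < R →
        Metric.closedBall 0 r ⊆ K → K ⊆ Metric.closedBall 0 R →
      -- the timing of predictions and observations, and the losses
      ∀ (τ : LatencyModel T) (f : Fin T → Vec k → ℝ) (G M lam : ℝ), 0 < lam →
        (∀ t, DifferentiableOn ℝ (f t) K) →
        (∀ t, ConvexOn ℝ K (f t)) →
        (∀ t, ∀ x ∈ K, ‖gradientWithin (f t) K x‖ ≤ G) →
        (∀ t, ∀ x ∈ K, |f t x| ≤ M) →
        (∀ t, IsStronglyConvex lam K (f t)) →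
      -- the smoothing parameters, with smoothness ratio `ν = M / (G r)`
      ∀ (δ : ℕ → ℝ),
        (IsRoundDependentSchedule k r (M / (G * r)) δ ∨ IsFixedSchedule k T r (M / (G * r)) δ) →
      -- the exploration directions: independent and uniform on the unit sphere
      ∀ (Ω : Type*) [MeasurableSpace Ω] (P : MeasureTheory.Measure Ω)
        [MeasureTheory.IsProbabilityMeasure P] (u : Fin T → Ω → UnitSphere k),
        (∀ t, Measurable (u t)) →
        (∀ t, P.map (u t) = unifSphere k) →
        ProbabilityTheory.iIndepFun u P →
      -- the initial point of P-FTRL and the best action in hindsight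
      ∀ z₁ ∈ K, ∀ xstar ∈ K, IsMinOn (fun x => ∑ t, f t x) K xstar →
        MeasureTheory.Integrable (fun ω =>
            regret (pFTRL K (fun n => 1 / (n * lam)) z₁) r δ τ f (fun t => u t ω) xstar) P ∧
          ∫ ω, regret (pFTRL K (fun n => 1 / (n * lam)) z₁) r δ τ f (fun t => u t ω) xstar ∂P ≤
            C * (G ^ 2 / lam *
              (min (τ.maxBacklog * Real.log T) (√(τ.totalDelay : ℝ)) +
                (T : ℝ) ^ (2 / 3 : ℝ) * Real.log T ^ (1 / 3 : ℝ) *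
                  (M / (G * r) * k) ^ (2 / 3 : ℝ))) :=
  ⟨204, by norm_num, fun _ _ hk hT _ _ _ hK hconv hr _ hrK _ τ _ _ _ _ hlam _ _ hgrad hM hstrong _
      hδ _ _ P _ _ hu hlaw hindep _ hz₁ _ hxstar _ =>
    mainTheorem2_general hk hT hK hconv hr hrK τ hlam (fun t => ⟨hgrad t, hstrong t⟩) hM hδ P hu
      hlaw hindep hz₁ hxstar⟩
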